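/- **Theorem.** Let $q\ge 2$ be even and let $(\alpha_n,\lambda_n)_{n\ge 0}$ be a $q$-periodic sequence with $|\alpha_n|<1$ and $|\lambda_n|=1$. Put $\rho_n=\sqrt{1-|\alpha_n|^2}$ and let $\mathcal C=\mathcal L_+\mathcal M_+$ be the CMV matrix on $\ell^2(\mathbb N)$ (basis $\delta_0,\delta_1,\dots$) with $$\mathcal L_+=\bigoplus_{j\ge 0}\Theta(\alpha_{2j},\lambda_{2j}),\qquad \mathcal M_+=1\oplus\bigoplus_{j\ge 0}\Theta(\alpha_{2j+1},\lambda_{2j+1}),\qquad \Theta(\alpha,\lambda)=\lambda\begin{bmatrix}\overline\alpha&\rho\\ \rho&-\alpha\end{bmatrix},\quad \rho=\sqrt{1-|\alpha|^2}$$ (the ordinary CMV matrix is the case $\lambda\equiv 1$). *Discriminant.* For $z\ne 0$ let $\Delta(z)=\mathrm{tr}\,\big(Y(q-1;z)\cdots Y(0;z)\big)$, where $$Y(n;z)=\frac1{\rho_n}\begin{bmatrix}-\alpha_n&\lambda_n z^{-1}\\ \lambda_n^{-1}z&-\overline{\alpha_n}\end{bmatrix}\ (n\text{ even}),\qquad Y(n;z)=\frac1{\rho_n}\begin{bmatrix}-\overline{\alpha_n}&\lambda_n^{-1}\\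 \lambda_n&-\alpha_n\end{bmatrix}\ (n\text{ odd}).$$ *Density of states.* The density of states measure of $\mathcal C$ is the probability measure $\nu$ on the unit circle with $$\int z^k\,d\nu=\lim_{N\to\infty}\int z^k\,d\nu_N\qquad(k=0,1,2,\dots),$$ where $\nu_N$ is the normalized eigenvalue counting measure (with algebraic multiplicities) of the restriction of $\mathcal C$ to $\ell^2(\{0,\dots,N-1\})$. *Schur functions.* For $j\ge 0$ let $\mathcal C_j$ be the CMV matrix built in the same way from the shifted sequence $(\alpha_{n+j},\lambda_{n+j})_{n\ge 0}$, let $\mu_j$ be its spectral measure at $\delta_0$, and for $|z|<1$ let $$F_j(z)=\int\frac{w+z}{w-z}\,d\mu_j(w),\qquad s_j(z)=\frac1z\,\frac{F_j(z)-1}{F_j(z)+1}$$ (extended analytically to $z=0$). Then the density of states measure $\nu$ exists, and for every $\tau\in\mathbb R$ with $\Delta(e^{i\tau})\in(-2,2)$: 1. for $0\le j\le \frac{q-2}2$ the boundary value $s_{2j}(e^{i\tau})=\lim_{z\to e^{i\tau},\,|z|<1}s_{2j}(z)$ exists and $|s_{2j}(e^{i\tau})|<1$; 2. the density $\dfrac{d\nu}{d\tau}$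 exists at $\tau$, i.e. $t\mapsto\nu(\{e^{is}:\tau-\pi<s\le t\})$ is differentiable at $t=\tau$ with derivative $\frac{d\nu}{d\tau}(\tau)$, and $$\frac{d\nu}{d\tau}(\tau)\ \ge\ \frac1{\pi q}\sum_{j=0}^{(q-2)/2}\frac1{1-|s_{2j}(e^{i\tau})|^2}.$$ -/

import Mathlib

open Complex Filter Topology MeasureTheory Set
open scoped ComplexConjugate CompactlySupported InnerProductSpace

noncomputable section

namespace CMV

/-! ### The Hilbert space and direct sums of `2 × 2` unitary blocks -/

/-- The Hilbert space `ℓ²(ℕ)`. -/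
abbrev Ell2 : Type := lp (fun _ : ℕ => ℂ) 2

/-- The standard basis vector `δ_n` of `ℓ²(ℕ)`. -/
def delta (n : ℕ) : Ell2 := lp.single 2 n (1 : ℂ)

/-- A linear bijection of sequences which preserves the square sum restricts to a unitary
operator of `ℓ²(ℕ)`. -/
def isoOfFun (T S : (ℕ → ℂ) →ₗ[ℂ] (ℕ → ℂ))
    (hT : ∀ f a, HasSum (fun n => ‖f n‖ ^ 2) a → HasSum (fun n => ‖T f n‖ ^ 2) a)
    (hS : ∀ f a, HasSum (fun n => ‖f n‖ ^ 2) a → HasSum (fun n => ‖S f n‖ ^ 2) a)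
    (hST : ∀ f, S (T f) = f) (hTS : ∀ f, T (S f) = f) : Ell2 ≃ₗᵢ[ℂ] Ell2 :=
  have mem : ∀ f : Ell2, Summable (fun n => ‖f n‖ ^ 2) := fun f => by
    simpa using (lp.memℓp f).summable (by norm_num)
  { toFun := fun f => ⟨T f, memℓp_gen (by simpa using (hT _ _ (mem f).hasSum).summable)⟩
    invFun := fun f => ⟨S f, memℓp_gen (by simpa using (hS _ _ (mem f).hasSum).summable)⟩
    map_add' := fun f g => by ext n; exact congrFun (T.map_add f g) n
    map_smul' := fun c f => by ext n; exact congrFun (T.map_smul c f) n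
    left_inv := fun f => by ext n; simp [hST]
    right_inv := fun f => by ext n; simp [hTS]
    norm_map' := fun f => by
      have h2 : (0 : ℝ) < (2 : ENNReal).toReal := by norm_num
      have e := (hT _ _ (mem f).hasSum).tsum_eq
      rw [lp.norm_eq_tsum_rpow h2, lp.norm_eq_tsum_rpow h2]
      congr 1
      simpa using e }

/-- The action of `B 0 ⊕ B 1 ⊕ B 2 ⊕ ⋯` on sequences, `B j` acting on the
coordinates `2 j` and `2 j + 1`. -/
def blockFun (B : ℕ → Matrix (Fin 2) (Fin 2) ℂ) : (ℕ → ℂ) →ₗ[ℂ] (ℕ → ℂ) where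
  toFun f n := ∑ k : Fin 2, B (n / 2) ⟨n % 2, Nat.mod_lt n two_pos⟩ k * f (2 * (n / 2) + k)
  map_add' f g := by ext n; simp; ring
  map_smul' c f := by ext n; simp; ring

/-- The action of `1 ⊕ B 0 ⊕ B 1 ⊕ ⋯` on sequences: `1` acts on the coordinate `0` and
`B j` on the coordinates `2 j + 1` and `2 j + 2`. -/
def blockFunOne (B : ℕ → Matrix (Fin 2) (Fin 2) ℂ) : (ℕ → ℂ) →ₗ[ℂ] (ℕ → ℂ) where
  toFun f n := Nat.casesOn n (f 0) (fun m => blockFun B (fun k => f (k + 1)) m)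
  map_add' f g := by
    ext n
    cases n with
    | zero => rfl
    | succ m => exact congrFun ((blockFun B).map_add (fun k => f (k + 1)) fun k => g (k + 1)) m
  map_smul' c f := by
    ext n
    cases n with
    | zero => rfl
    | succ m => exact congrFun ((blockFun B).map_smul c fun k => f (k + 1)) m

lemma blockFun_even (B : ℕ → Matrix (Fin 2) (Fin 2) ℂ) (f : ℕ → ℂ) (j : ℕ) :
    blockFun B f (2 * j) = B j 0 0 * f (2 * j) + B j 0 1 * f (2 * j + 1) := by
  have h1 : 2 * j / 2 = j := by omega
  have h2 : 2 * j % 2 = 0 := by omega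
  simp [blockFun, h1, h2]

lemma blockFun_odd (B : ℕ → Matrix (Fin 2) (Fin 2) ℂ) (f : ℕ → ℂ) (j : ℕ) :
    blockFun B f (2 * j + 1) = B j 1 0 * f (2 * j) + B j 1 1 * f (2 * j + 1) := by
  have h1 : (2 * j + 1) / 2 = j := by omega
  have h2 : (2 * j + 1) % 2 = 1 := by omega
  simp [blockFun, h1, h2]

lemma blockFun_mul (B C : ℕ → Matrix (Fin 2) (Fin 2) ℂ) (h : ∀ j, B j * C j = 1) (f : ℕ → ℂ) :
    blockFun B (blockFun C f) = f := by
  ext n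
  have e := fun j i k => congrFun (congrFun (h j) i) k
  simp only [Matrix.mul_apply, Fin.sum_univ_two] at e
  obtain ⟨j, rfl | rfl⟩ := Nat.even_or_odd' n
  · rw [blockFun_even, blockFun_even, blockFun_odd]
    have e1 := e j 0 0
    have e2 := e j 0 1
    simp at e1 e2
    linear_combination f (2 * j) * e1 + f (2 * j + 1) * e2
  · rw [blockFun_odd, blockFun_even, blockFun_odd]
    have e1 := e j 1 0
    have e2 := e j 1 1
    simp at e1 e2
    linear_combination f (2 * j) * e1 + f (2 * j + 1) * e2

lemma norm_sq_block {B : Matrix (Fin 2) (Fin 2) ℂ} (h : star B * B = 1) (x y : ℂ) :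
    ‖B 0 0 * x + B 0 1 * y‖ ^ 2 + ‖B 1 0 * x + B 1 1 * y‖ ^ 2 = ‖x‖ ^ 2 + ‖y‖ ^ 2 := by
  have e := fun i k => congrFun (congrFun h i) k
  simp only [Matrix.mul_apply, Fin.sum_univ_two, Matrix.star_apply] at e
  have e1 := e 0 0
  have e2 := e 0 1
  have e3 := e 1 0
  have e4 := e 1 1
  simp only [RCLike.star_def, Matrix.one_apply, Fin.isValue, if_true, zero_ne_one, one_ne_zero,
    if_false] at e1 e2 e3 e4
  apply Complex.ofReal_injective
  push_cast
  simp only [← Complex.mul_conj', map_add, map_mul]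
  linear_combination x * conj x * e1 + conj x * y * e2 + conj y * x * e3 + y * conj y * e4

lemma hasSum_of_pairs (g h : ℕ → ℝ) (hg : ∀ n, 0 ≤ g n)
    (key : ∀ j, g (2 * j) + g (2 * j + 1) = h (2 * j) + h (2 * j + 1)) (a : ℝ) (hh : HasSum h a) :
    HasSum g a := by
  have i0 : Function.Injective (fun k : ℕ => 2 * k) := fun x y hxy => by simpa using hxy
  have i1 : Function.Injective (fun k : ℕ => 2 * k + 1) := fun x y hxy => by simpa using hxy
  have s0 : Summable fun j => h (2 * j) := hh.summable.comp_injective i0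
  have s1 : Summable fun j => h (2 * j + 1) := hh.summable.comp_injective i1
  have t0 : Summable fun j => g (2 * j) := Summable.of_nonneg_of_le (fun _ => hg _)
    (fun j => by linarith [key j, hg (2 * j + 1)]) (s0.add s1)
  have t1 : Summable fun j => g (2 * j + 1) := Summable.of_nonneg_of_le (fun _ => hg _)
    (fun j => by linarith [key j, hg (2 * j)]) (s0.add s1)
  have ht := HasSum.even_add_odd (f := g) t0.hasSum t1.hasSum
  have hs := (HasSum.even_add_odd (f := h) s0.hasSum s1.hasSum).unique hh
  rw [← t0.tsum_add t1, tsum_congr key, s0.tsum_add s1, hs] at ht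
  exact ht

lemma hasSum_blockFun (B : ℕ → Matrix (Fin 2) (Fin 2) ℂ) (h : ∀ j, star (B j) * B j = 1)
    (f : ℕ → ℂ) (a : ℝ) (hf : HasSum (fun n => ‖f n‖ ^ 2) a) :
    HasSum (fun n => ‖blockFun B f n‖ ^ 2) a :=
  hasSum_of_pairs _ (fun n => ‖f n‖ ^ 2) (fun _ => sq_nonneg _)
    (fun j => by
      rw [blockFun_even, blockFun_odd]
      exact norm_sq_block (h j) _ _) a hf

lemma hasSum_blockFunOne (B : ℕ → Matrix (Fin 2) (Fin 2) ℂ) (h : ∀ j, star (B j) * B j = 1)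
    (f : ℕ → ℂ) (a : ℝ) (hf : HasSum (fun n => ‖f n‖ ^ 2) a) :
    HasSum (fun n => ‖blockFunOne B f n‖ ^ 2) a := by
  rw [← hasSum_nat_add_iff' 1] at hf ⊢
  simp only [Finset.range_one, Finset.sum_singleton] at hf ⊢
  exact hasSum_blockFun B h (fun k => f (k + 1)) _ hf

lemma blockFunOne_mul (B C : ℕ → Matrix (Fin 2) (Fin 2) ℂ) (h : ∀ j, B j * C j = 1)
    (f : ℕ → ℂ) : blockFunOne B (blockFunOne C f) = f := by
  ext n
  cases n with
  | zero => rfl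
  | succ m => exact congrFun (blockFun_mul B C h fun k => f (k + 1)) m

/-- The unitary operator `B 0 ⊕ B 1 ⊕ ⋯` on `ℓ²(ℕ)`. -/
def blockSum (B : ℕ → Matrix.unitaryGroup (Fin 2) ℂ) : Ell2 ≃ₗᵢ[ℂ] Ell2 :=
  isoOfFun (blockFun fun j => B j) (blockFun fun j => star (B j : Matrix (Fin 2) (Fin 2) ℂ))
    (hasSum_blockFun _ fun j => Unitary.coe_star_mul_self (B j))
    (hasSum_blockFun _ fun j => by rw [star_star]; exact Unitary.coe_mul_star_self (B j))
    (blockFun_mul _ _ fun j => Unitary.coe_star_mul_self (B j))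
    (blockFun_mul _ _ fun j => Unitary.coe_mul_star_self (B j))

/-- The unitary operator `1 ⊕ B 0 ⊕ B 1 ⊕ ⋯` on `ℓ²(ℕ)`. -/
def blockSumOne (B : ℕ → Matrix.unitaryGroup (Fin 2) ℂ) : Ell2 ≃ₗᵢ[ℂ] Ell2 :=
  isoOfFun (blockFunOne fun j => B j)
    (blockFunOne fun j => star (B j : Matrix (Fin 2) (Fin 2) ℂ))
    (hasSum_blockFunOne _ fun j => Unitary.coe_star_mul_self (B j))
    (hasSum_blockFunOne _ fun j => by rw [star_star]; exact Unitary.coe_mul_star_self (B j))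
    (blockFunOne_mul _ _ fun j => Unitary.coe_star_mul_self (B j))
    (blockFunOne_mul _ _ fun j => Unitary.coe_mul_star_self (B j))

/-! ### CMV matrices -/

/-- `ρ = √(1 - |α|²)`. -/
def rho (a : UnitDisc) : ℝ := Real.sqrt (1 - ‖(a : ℂ)‖ ^ 2)

lemma rho_sq (a : UnitDisc) : rho a ^ 2 = 1 - ‖(a : ℂ)‖ ^ 2 :=
  Real.sq_sqrt (by have := a.sq_norm_lt_one; linarith)

/-- The matrix `Θ(α, λ)`. -/
def thetaMatrix (a : UnitDisc) (l : Circle) : Matrix (Fin 2) (Fin 2) ℂ :=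
  (l : ℂ) • !![conj (a : ℂ), (rho a : ℂ); (rho a : ℂ), -(a : ℂ)]

lemma thetaMatrix_mem (a : UnitDisc) (l : Circle) :
    thetaMatrix a l ∈ Matrix.unitaryGroup (Fin 2) ℂ := by
  rw [Matrix.mem_unitaryGroup_iff]
  have h1 : (l : ℂ) * conj (l : ℂ) = 1 := by
    rw [Complex.mul_conj', Circle.norm_coe]; simp
  have h2 : (rho a : ℂ) ^ 2 = 1 - (a : ℂ) * conj (a : ℂ) := by
    rw [Complex.mul_conj']; exact_mod_cast rho_sq a
  ext i k
  fin_cases i <;> fin_cases k <;>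
    simp [thetaMatrix, Matrix.mul_apply, Fin.sum_univ_two]
  · linear_combination h1 + (l : ℂ) * conj (l : ℂ) * h2
  · ring
  · ring
  · linear_combination h1 + (l : ℂ) * conj (l : ℂ) * h2

/-- `Θ(α, λ)` as a unitary matrix. -/
def theta (a : UnitDisc) (l : Circle) : Matrix.unitaryGroup (Fin 2) ℂ :=
  ⟨thetaMatrix a l, thetaMatrix_mem a l⟩

/-- `ℒ₊ = Θ(α₀, λ₀) ⊕ Θ(α₂, λ₂) ⊕ ⋯`. -/
def opL (α : ℕ → UnitDisc) (lam : ℕ → Circle) : Ell2 ≃ₗᵢ[ℂ] Ell2 :=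
  blockSum fun j => theta (α (2 * j)) (lam (2 * j))

/-- `ℳ₊ = 1 ⊕ Θ(α₁, λ₁) ⊕ Θ(α₃, λ₃) ⊕ ⋯`. -/
def opM (α : ℕ → UnitDisc) (lam : ℕ → Circle) : Ell2 ≃ₗᵢ[ℂ] Ell2 :=
  blockSumOne fun j => theta (α (2 * j + 1)) (lam (2 * j + 1))

/-- The CMV matrix `𝒞 = ℒ₊ ℳ₊` with Verblunsky coefficients `α` and phases `lam`, a unitary
operator on `ℓ²(ℕ)`. The ordinary CMV matrix is the case `lam = 1`. -/
def cmv (α : ℕ → UnitDisc) (lam : ℕ → Circle) : unitary (Ell2 →L[ℂ] Ell2) :=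
  Unitary.linearIsometryEquiv.symm ((opM α lam).trans (opL α lam))

/-! ### Spectral measures, Carathéodory and Schur functions -/

section Spectral

variable {H : Type*} [NormedAddCommGroup H] [InnerProductSpace ℂ H] [CompleteSpace H]

/-- The positive functional `f ↦ ⟨v, f(T) v⟩` on real continuous functions on the spectrum of a
normal operator `T`, `f(T)` being given by the continuous functional calculus. -/
def spectralFunctional (T : H →L[ℂ] H) (hT : IsStarNormal T) (v : H) :
    C_c(spectrum ℂ T, ℝ) →ₚ[ℝ] ℝ :=
  PositiveLinearMap.mk₀
    { toFun := fun f => (⟪v, cfcHom hT ((⟨fun x => (f x : ℂ), by fun_prop⟩ :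
        C(spectrum ℂ T, ℂ))) v⟫_ℂ).re
      map_add' := fun f g => by
        rw [← Complex.add_re, ← inner_add_right, ← add_apply, ← map_add]
        congr 5
        ext x
        simp
      map_smul' := fun c f => by
        have : (⟨fun x => ((c • f) x : ℂ), by fun_prop⟩ : C(spectrum ℂ T, ℂ))
            = (c : ℂ) • ⟨fun x => (f x : ℂ), by fun_prop⟩ := by
          ext x
          simp
        rw [this, map_smul, smul_apply, inner_smul_right]
        simp }
    (fun f hf => by
      set g : C(spectrum ℂ T, ℂ) := ⟨fun x => (Real.sqrt (f x) : ℂ), by fun_prop⟩ with hg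
      have e : (⟨fun x => (f x : ℂ), by fun_prop⟩ : C(spectrum ℂ T, ℂ)) = star g * g := by
        ext x
        have : 0 ≤ f x := hf x
        simp [hg, ← Complex.ofReal_mul, Real.mul_self_sqrt this]
      change 0 ≤ (⟪v, cfcHom hT (⟨fun x => (f x : ℂ), by fun_prop⟩ :
        C(spectrum ℂ T, ℂ)) v⟫_ℂ).re
      rw [e, map_mul, map_star, ContinuousLinearMap.star_eq_adjoint,
        mul_apply_eq_comp, ContinuousLinearMap.adjoint_inner_right]
      exact inner_self_nonneg (𝕜 := ℂ))

/-- The spectral measure of the normal operator `T` at the vector `v`: the Borel measure `μ` with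
`∫ f dμ = ⟨v, f(T) v⟩` for continuous `f` on the spectrum of `T`. -/
def spectralMeasure (T : H →L[ℂ] H) (hT : IsStarNormal T) (v : H) : Measure ℂ :=
  (RealRMK.rieszMeasure (spectralFunctional T hT v)).map Subtype.val

end Spectral

lemma isStarNormal_cmv (α : ℕ → UnitDisc) (lam : ℕ → Circle) :
    IsStarNormal (cmv α lam : Ell2 →L[ℂ] Ell2) := inferInstance

/-- The spectral measure of the CMV matrix (at the cyclic vector `δ₀`). -/
def cmvMeasure (α : ℕ → UnitDisc) (lam : ℕ → Circle) : Measure ℂ :=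
  spectralMeasure (cmv α lam) (isStarNormal_cmv α lam) (delta 0)

/-- The Carathéodory function `F(z) = ∫ (w + z) / (w - z) dμ(w)`, `z ∈ 𝔻`. -/
def caratheodory (α : ℕ → UnitDisc) (lam : ℕ → Circle) (z : ℂ) : ℂ :=
  ∫ w, (w + z) / (w - z) ∂(cmvMeasure α lam)

/-- The Schur function `s(z) = z⁻¹ (F(z) - 1) / (F(z) + 1)`, `z ∈ 𝔻`. As `F(0) = 1`, this is a
difference quotient at `0`, which `dslope` extends to `z = 0` by the derivative. -/
def schur (α : ℕ → UnitDisc) (lam : ℕ → Circle) : ℂ → ℂ :=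
  dslope (fun z => (caratheodory α lam z - 1) / (caratheodory α lam z + 1)) 0

/-! ### Monodromy matrix and discriminant -/

/-- The transfer matrix `P(α, λ; z)`. -/
def transferP (a : UnitDisc) (l : Circle) : Matrix (Fin 2) (Fin 2) ℂ :=
  (rho a : ℂ)⁻¹ • !![-conj (a : ℂ), (l : ℂ)⁻¹; (l : ℂ), -(a : ℂ)]

/-- The transfer matrix `Q(α, λ; z)`. -/
def transferQ (a : UnitDisc) (l : Circle) (z : ℂ) : Matrix (Fin 2) (Fin 2) ℂ :=
  (rho a : ℂ)⁻¹ • !![-(a : ℂ), (l : ℂ) * z⁻¹; (l : ℂ)⁻¹ * z, -conj (a : ℂ)]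

/-- The one-step transfer matrix `Y(n; z)`: `Q` for even `n` and `P` for odd `n`. -/
def transferY (α : ℕ → UnitDisc) (lam : ℕ → Circle) (z : ℂ) (n : ℕ) :
    Matrix (Fin 2) (Fin 2) ℂ :=
  if Even n then transferQ (α n) (lam n) z else transferP (α n) (lam n)

/-- `Z(n, 0; z) = Y(n - 1; z) ⋯ Y(0; z)`. -/
def transferZ (α : ℕ → UnitDisc) (lam : ℕ → Circle) (z : ℂ) : ℕ → Matrix (Fin 2) (Fin 2) ℂ
  | 0 => 1
  | n + 1 => transferY α lam z n * transferZ α lam z n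

/-- The discriminant `Δ(z) = tr Φ(z)`, with `Φ(z) = Z(q, 0; z)` the monodromy matrix. -/
def discriminant (q : ℕ) (α : ℕ → UnitDisc) (lam : ℕ → Circle) (z : ℂ) : ℂ :=
  (transferZ α lam z q).trace

/-! ### Density of states -/

/-- The restriction of an operator to `ℓ²({0, …, N - 1})`, as a matrix. -/
def truncation (T : Ell2 →L[ℂ] Ell2) (N : ℕ) : Matrix (Fin N) (Fin N) ℂ :=
  Matrix.of fun i k => ⟪delta i, T (delta k)⟫_ℂ

/-- The normalized eigenvalue counting measure of a matrix (eigenvalues counted with algebraic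
multiplicity). -/
def countingMeasure {N : ℕ} (A : Matrix (Fin N) (Fin N) ℂ) : Measure ℂ :=
  (N : ENNReal)⁻¹ • (A.charpoly.roots.map Measure.dirac).sum

/-- `ν` is the density of states measure of the unitary operator `T`: the probability measure on
the unit circle to which the normalized eigenvalue counting measures of the truncations of `T`
converge. The truncations are not unitary and their eigenvalues may lie inside the disc (they all
vanish for zero Verblunsky coefficients), so the convergence is that of the integrals of `z ^ k`,
`k ≥ 0`. These integrals determine a measure on the circle, and they converge whenever the
counting measures converge weakly, since the eigenvalues lie in the closed unit disc. -/
structure IsDensityOfStates (T : Ell2 →L[ℂ] Ell2) (ν : Measure ℂ) : Prop where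
  isProb : IsProbabilityMeasure ν
  onCircle : ν (Metric.sphere (0 : ℂ) 1)ᶜ = 0
  moments : ∀ k : ℕ, Tendsto (fun N : ℕ => ∫ z, z ^ k ∂(countingMeasure (truncation T N))) atTop
    (𝓝 (∫ z, z ^ k ∂ν))

/-- The function `t ↦ ν({e^{is} : τ - π < s ≤ t})`, the distribution function of `ν` in the
angular variable, based at `τ - π`. -/
def angularCDF (ν : Measure ℂ) (τ t : ℝ) : ℝ :=
  ν.real ((fun s : ℝ => Complex.exp (s * I)) '' Ioc (τ - Real.pi) t)

end CMV

end

/-! The `k`-th moment of the eigenvalue counting measure is `tr (A ^ k) / N` for the truncation `A`.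
Since `𝒞` is unitary and banded, it differs by `O(1/N)` from the average of the diagonal entries
`⟨δ_n, 𝒞 ^ k δ_n⟩`, `n < N` (`tendsto_moments_iff`). These entries are exactly `q`-periodic in `n`
for `n ≥ 2k`, so the moments converge, and a weak cluster point of the averaged spectral measures is
a density of states measure.

Summing the moments against powers of `z` expresses the Herglotz integral of `ν` as a mean over
residues `r` of the limits of the diagonal entries of `(𝒞 + z)(𝒞 - z)⁻¹` along `n ≡ r` modulo `q`
(`herglotz_densityOfStates`). Such an entry is a product of two solutions of the transfer recursion
(`one_add_resolventVec_diag`): one starts from `(1, 1)`, the other is the decaying solution, which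
starts from `(1, z s₀(z))` (`decays_schur`). Expanding `(1, 1)` in eigenvectors of the monodromy
matrix leaves a constant term and a geometrically decaying one.

On the unit circle the transfer matrices preserve `|v₀|² - |v₁|²` up to sign. If `Δ` lies in `(-2,
2)` the monodromy matrix is elliptic, and exactly one of its eigenvectors has the form `(1, w)` with
`|w| < 1`. Hence `z s₀(z)` converges to `w` without restriction on the approach, and with `v = Z(r)
(1, w)` the Poisson integral of `ν` tends to the mean over `r` of `(|v₀|² + |v₁|²) / (1 - |w|²)`.
Such boundary values on an arc are `2π` times the density (`hasDerivAt_angularCDF`).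

For the inequality, `|v₀|² - |v₁|² = (-1)^r (1 - |w|²)`, while `|v₁| = |s_r| |v₀|` for even `r`. An
even term therefore equals `(1 + |s_r|²) / (1 - |s_r|²)` and an odd one is at least `1`; two
consecutive terms contribute at least `2 / (1 - |s_r|²)`. -/

noncomputable section
namespace CMV

/-! ### Traces of powers -/

/-- Both sides are multiplicative in `p`, so splitting `p` reduces the claim to constants and linear
factors, where it is the characteristic polynomial evaluated at a point. -/
lemma det_aeval_eq_prod_roots {n : Type*} [Fintype n] [DecidableEq n] (A : Matrix n n ℂ)
    (p : Polynomial ℂ) :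
    (Polynomial.aeval A p).det = (A.charpoly.roots.map fun r => p.eval r).prod := by
  have hA := IsAlgClosed.splits A.charpoly
  have hp := IsAlgClosed.splits p
  have key : ∀ s : Multiset ℂ, (Polynomial.aeval A
      (s.map fun a => Polynomial.X - Polynomial.C a).prod).det
      = (A.charpoly.roots.map fun r => (s.map fun a => r - a).prod).prod := by
    intro s
    induction s using Multiset.induction with
    | empty => simp
    | cons a s ih =>
      have h1 : (A - algebraMap ℂ _ a).det = (A.charpoly.roots.map fun r => r - a).prod := by
        have h2 : (A - algebraMap ℂ _ a).det = (-1) ^ Fintype.card n * A.charpoly.eval a := by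
          rw [Matrix.eval_charpoly, ← Matrix.det_neg]
          congr 1
          ext i j
          simp [Matrix.algebraMap_matrix_apply, Matrix.scalar_apply, Matrix.diagonal]
        rw [h2, hA.eval_eq_prod_roots_of_monic A.charpoly_monic, ← Matrix.charpoly_natDegree_eq_dim A,
          hA.natDegree_eq_card_roots, ← Multiset.card_map (fun r => a - r),
          ← Multiset.prod_map_neg, Multiset.map_map]
        simp
      simp only [Multiset.map_cons, Multiset.prod_cons, map_mul, Matrix.det_mul, ih,
        Multiset.prod_map_mul]
      rw [← h1]
      simp
  rw [hp.eq_prod_roots]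
  simp only [Polynomial.eval_mul, Polynomial.eval_C, map_mul, Matrix.det_mul, key,
    Multiset.prod_map_mul, Polynomial.aeval_C]
  congr 1
  · rw [Algebra.algebraMap_eq_smul_one, Matrix.det_smul, Multiset.map_const', Multiset.prod_replicate,
      ← hA.natDegree_eq_card_roots, Matrix.charpoly_natDegree_eq_dim]
    simp
  · simp [Polynomial.eval_multiset_prod]

/-- Taking `p = x - X ^ k` in the determinant formula gives the characteristic polynomial of `A ^ k`
at `x`, with multiplicities and without triangularizing `A`. -/
lemma trace_pow_eq_sum_roots {n : Type*} [Fintype n] [DecidableEq n] (A : Matrix n n ℂ) (k : ℕ) :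
    (A ^ k).trace = (A.charpoly.roots.map fun r => r ^ k).sum := by
  have h : (A ^ k).charpoly = ((A.charpoly.roots.map fun r => r ^ k).map
      fun a => Polynomial.X - Polynomial.C a).prod := by
    refine Polynomial.funext fun x => ?_
    have := det_aeval_eq_prod_roots A (Polynomial.C x - Polynomial.X ^ k)
    rw [Matrix.eval_charpoly, Polynomial.eval_multiset_prod]
    simp only [map_sub, Polynomial.aeval_C, map_pow, Polynomial.aeval_X, Polynomial.eval_sub,
      Polynomial.eval_C, Polynomial.eval_pow, Polynomial.eval_X] at this
    simpa [Multiset.map_map, Matrix.algebraMap_eq_diagonal, Pi.algebraMap_def] using this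
  rw [Matrix.trace_eq_sum_roots_charpoly, h, Polynomial.roots_multiset_prod_X_sub_C]

lemma integral_multiset_dirac (s : Multiset ℂ) (f : ℂ → ℂ) :
    Integrable f (s.map Measure.dirac).sum ∧
      ∫ z, f z ∂(s.map Measure.dirac).sum = (s.map f).sum := by
  induction s using Multiset.induction with
  | empty => simp
  | cons a s ih =>
    have hi : Integrable f (Measure.dirac a) := integrable_dirac (by simp)
    simp only [Multiset.map_cons, Multiset.sum_cons]
    exact ⟨hi.add_measure ih.1, by rw [integral_add_measure hi ih.1, ih.2, integral_dirac]⟩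

lemma integral_pow_countingMeasure {N : ℕ} (A : Matrix (Fin N) (Fin N) ℂ) (k : ℕ) :
    ∫ z, z ^ k ∂(countingMeasure A) = (N : ℂ)⁻¹ * (A ^ k).trace := by
  rw [countingMeasure, integral_smul_measure, (integral_multiset_dirac _ _).2,
    trace_pow_eq_sum_roots]
  simp

/-! ### The action on sequences -/

/-- The action of `𝓜₊` on sequences. -/
def seqM (α : ℕ → UnitDisc) (lam : ℕ → Circle) : (ℕ → ℂ) →ₗ[ℂ] (ℕ → ℂ) :=
  blockFunOne fun j => (theta (α (2 * j + 1)) (lam (2 * j + 1)) : Matrix (Fin 2) (Fin 2) ℂ)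

/-- The action of `𝓛₊` on sequences. -/
def seqL (α : ℕ → UnitDisc) (lam : ℕ → Circle) : (ℕ → ℂ) →ₗ[ℂ] (ℕ → ℂ) :=
  blockFun fun j => (theta (α (2 * j)) (lam (2 * j)) : Matrix (Fin 2) (Fin 2) ℂ)

/-- The action of the CMV matrix on sequences. -/
def seqC (α : ℕ → UnitDisc) (lam : ℕ → Circle) : (ℕ → ℂ) →ₗ[ℂ] (ℕ → ℂ) :=
  seqL α lam ∘ₗ seqM α lam

variable (α : ℕ → UnitDisc) (lam : ℕ → Circle)

lemma coe_cmv_apply (f : Ell2) : ((cmv α lam : Ell2 →L[ℂ] Ell2) f : ℕ → ℂ) = seqC α lam f := rfl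

lemma seqM_zero (f : ℕ → ℂ) : seqM α lam f 0 = f 0 := rfl

lemma seqM_odd (f : ℕ → ℂ) (j : ℕ) : seqM α lam f (2 * j + 1) = (lam (2 * j + 1) : ℂ) *
    (conj (α (2 * j + 1) : ℂ) * f (2 * j + 1) + rho (α (2 * j + 1)) * f (2 * j + 2)) := by
  have := blockFun_even (fun j => (theta (α (2 * j + 1)) (lam (2 * j + 1)) :
    Matrix (Fin 2) (Fin 2) ℂ)) (fun k => f (k + 1)) j
  refine Eq.trans this ?_
  simp [theta, thetaMatrix]; ring

lemma seqM_even (f : ℕ → ℂ) (j : ℕ) : seqM α lam f (2 * j + 2) = (lam (2 * j + 1) : ℂ) *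
    (rho (α (2 * j + 1)) * f (2 * j + 1) - α (2 * j + 1) * f (2 * j + 2)) := by
  have := blockFun_odd (fun j => (theta (α (2 * j + 1)) (lam (2 * j + 1)) :
    Matrix (Fin 2) (Fin 2) ℂ)) (fun k => f (k + 1)) j
  refine Eq.trans this ?_
  simp [theta, thetaMatrix]; ring

lemma seqL_even (f : ℕ → ℂ) (j : ℕ) : seqL α lam f (2 * j) = (lam (2 * j) : ℂ) *
    (conj (α (2 * j) : ℂ) * f (2 * j) + rho (α (2 * j)) * f (2 * j + 1)) := by
  refine (blockFun_even _ f j).trans ?_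
  simp [theta, thetaMatrix]; ring

lemma seqL_odd (f : ℕ → ℂ) (j : ℕ) : seqL α lam f (2 * j + 1) = (lam (2 * j) : ℂ) *
    (rho (α (2 * j)) * f (2 * j) - α (2 * j) * f (2 * j + 1)) := by
  refine (blockFun_odd _ f j).trans ?_
  simp [theta, thetaMatrix]; ring

lemma hasSum_seqC (f : ℕ → ℂ) (a : ℝ) (hf : HasSum (fun n => ‖f n‖ ^ 2) a) :
    HasSum (fun n => ‖seqC α lam f n‖ ^ 2) a := by
  have h1 : HasSum (fun n => ‖seqM α lam f n‖ ^ 2) a := hasSum_blockFunOne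
    (fun j => (theta (α (2 * j + 1)) (lam (2 * j + 1)) : Matrix (Fin 2) (Fin 2) ℂ))
    (fun j => Unitary.coe_star_mul_self (theta (α (2 * j + 1)) (lam (2 * j + 1)))) f a hf
  exact hasSum_blockFun (fun j => (theta (α (2 * j)) (lam (2 * j)) : Matrix (Fin 2) (Fin 2) ℂ))
    (fun j => Unitary.coe_star_mul_self (theta (α (2 * j)) (lam (2 * j)))) _ a h1

/-- The CMV matrix has bandwidth two. -/
lemma seqC_congr {f f' : ℕ → ℂ} {n : ℕ} (h : ∀ m, m ≤ n + 2 → n ≤ m + 2 → f m = f' m) :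
    seqC α lam f n = seqC α lam f' n := by
  have hM : ∀ m, m ≤ n + 1 → n ≤ m + 1 → seqM α lam f m = seqM α lam f' m := by
    intro m h1 h2
    obtain _ | m := m
    · exact h 0 (by omega) (by omega)
    obtain ⟨j, rfl | rfl⟩ := Nat.even_or_odd' m
    · rw [seqM_odd, seqM_odd, h _ (by omega) (by omega), h _ (by omega) (by omega)]
    · rw [seqM_even, seqM_even, h _ (by omega) (by omega), h _ (by omega) (by omega)]
  obtain ⟨j, rfl | rfl⟩ := Nat.even_or_odd' n
  · change seqL _ _ _ _ = seqL _ _ _ _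
    rw [seqL_even, seqL_even, hM _ (by omega) (by omega), hM _ (by omega) (by omega)]
  · change seqL _ _ _ _ = seqL _ _ _ _
    rw [seqL_odd, seqL_odd, hM _ (by omega) (by omega), hM _ (by omega) (by omega)]

/-- Away from the boundary a periodic CMV matrix commutes with the shift by a period. -/
lemma seqC_shift {q : ℕ} (hq : Even q) (hα : ∀ n, α (n + q) = α n)
    (hlam : ∀ n, lam (n + q) = lam n) {f f' : ℕ → ℂ} {n : ℕ} (hn : 2 ≤ n)
    (h : ∀ m, m ≤ n + 2 → n ≤ m + 2 → f' (m + q) = f m) :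
    seqC α lam f' (n + q) = seqC α lam f n := by
  obtain ⟨p, rfl⟩ := hq
  -- Coordinate `0`, where `𝓜₊` acts as the summand `1`, has no counterpart at `q`; this forces `1 ≤
  -- m` here and `2 ≤ n` above.
  have hM : ∀ m, 1 ≤ m → m ≤ n + 1 → n ≤ m + 1 →
      seqM α lam f' (m + (p + p)) = seqM α lam f m := by
    intro m h0 h1 h2
    obtain _ | m := m
    · omega
    have e1 := hα
    have e2 := hlam
    obtain ⟨j, rfl | rfl⟩ := Nat.even_or_odd' m
    · have i1 : 2 * j + 1 + (p + p) = 2 * (j + p) + 1 := by ring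
      have i2 : 2 * (j + p) + 2 = 2 * j + 2 + (p + p) := by ring
      rw [i1, seqM_odd, seqM_odd, i2, ← i1, h _ (by omega) (by omega), h _ (by omega) (by omega),
        hα, hlam]
    · have i1 : 2 * j + 1 + 1 + (p + p) = 2 * (j + p) + 2 := by ring
      have i2 : 2 * (j + p) + 1 = 2 * j + 1 + (p + p) := by ring
      rw [i1, seqM_even, seqM_even, i2, ← i1, h _ (by omega) (by omega),
        h _ (by omega) (by omega), hα, hlam]
  obtain ⟨j, rfl | rfl⟩ := Nat.even_or_odd' n
  · change seqL _ _ _ _ = seqL _ _ _ _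
    have i1 : 2 * j + (p + p) = 2 * (j + p) := by ring
    have i2 : 2 * (j + p) + 1 = 2 * j + 1 + (p + p) := by ring
    rw [i1, seqL_even, seqL_even, i2, ← i1, hM _ (by omega) (by omega) (by omega),
      hM _ (by omega) (by omega) (by omega), hα, hlam]
  · change seqL _ _ _ _ = seqL _ _ _ _
    have i1 : 2 * j + 1 + (p + p) = 2 * (j + p) + 1 := by ring
    have i2 : 2 * (j + p) = 2 * j + (p + p) := by ring
    rw [i1, seqL_odd, seqL_odd, ← i1, i2, hM _ (by omega) (by omega) (by omega),
      hM _ (by omega) (by omega) (by omega), hα, hlam]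

end CMV
end

noncomputable section
namespace CMV

/-! ### Averages along residue classes -/

lemma tendsto_of_residues {q : ℕ} (hq : 0 < q) {a : ℕ → ℂ} {l : ℂ}
    (h : ∀ r < q, Tendsto (fun m => a (r + q * m)) atTop (𝓝 l)) : Tendsto a atTop (𝓝 l) := by
  rw [Metric.tendsto_atTop]
  intro ε hε
  have h' : ∀ r, ∃ M, r < q → ∀ m ≥ M, dist (a (r + q * m)) l < ε := by
    intro r
    by_cases hr : r < q
    · obtain ⟨M, hM⟩ := Metric.tendsto_atTop.1 (h r hr) ε hε
      exact ⟨M, fun _ => hM⟩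
    · exact ⟨0, fun h => absurd h hr⟩
  choose M hM using h'
  refine ⟨q * (∑ r ∈ Finset.range q, M r + 1), fun n hn => ?_⟩
  have hr := Nat.mod_lt n hq
  have := hM (n % q) hr (n / q) (by
    have h1 : M (n % q) ≤ ∑ r ∈ Finset.range q, M r :=
      Finset.single_le_sum (f := M) (fun _ _ => Nat.zero_le _) (Finset.mem_range.2 hr)
    have h2 : ∑ r ∈ Finset.range q, M r + 1 ≤ n / q := by
      rw [Nat.le_div_iff_mul_le hq]; linarith
    omega)
  rwa [Nat.mod_add_div] at this

/-- If a sequence converges along every residue class modulo `q`, its averages converge to the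
mean of the limits. -/
lemma tendsto_average_of_residues {q : ℕ} (hq : 0 < q) {a : ℕ → ℂ} {l : ℕ → ℂ}
    (h : ∀ r < q, Tendsto (fun m => a (r + q * m)) atTop (𝓝 (l r))) :
    Tendsto (fun N : ℕ => (N : ℂ)⁻¹ * ∑ n ∈ Finset.range N, a n) atTop
      (𝓝 ((q : ℂ)⁻¹ * ∑ r ∈ Finset.range q, l r)) := by
  -- Compare with the periodic sequence of limits: `a - p` tends to `0`, hence so do its Cesàro
  -- means, and the partial sums of `p` differ from `N` times the mean by a bounded amount.
  set p : ℕ → ℂ := fun n => l (n % q) with hp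
  have h0 : Tendsto (fun n => a n - p n) atTop (𝓝 0) := by
    refine tendsto_of_residues hq fun r hr => ?_
    have : ∀ m, p (r + q * m) = l r := fun m => by
      simp [hp, Nat.add_mul_mod_self_left, Nat.mod_eq_of_lt hr]
    simp only [this]
    simpa using (h r hr).sub_const (l r)
  have h1 := h0.cesaro_smul
  set S := ∑ r ∈ Finset.range q, l r with hS
  have hblock : ∀ m, ∑ n ∈ Finset.range (q * m), p n = m * S := by
    intro m
    induction m with
    | zero => simp
    | succ m ih =>
      rw [Nat.mul_succ, Finset.sum_range_add, ih]
      have : ∑ x ∈ Finset.range q, p (q * m + x) = S := by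
        refine Finset.sum_congr rfl fun x hx => ?_
        simp [hp, Nat.mod_eq_of_lt (Finset.mem_range.1 hx)]
      rw [this]; push_cast; ring
  set B := ∑ r ∈ Finset.range q, ‖l r‖ with hB
  have h2 : ∀ N, ‖∑ n ∈ Finset.range N, p n - (N : ℂ) * ((q : ℂ)⁻¹ * S)‖ ≤ 2 * B := by
    intro N
    have hqC : (q : ℂ) ≠ 0 := by exact_mod_cast hq.ne'
    have hlt := Nat.mod_lt N hq
    have e : ∑ n ∈ Finset.range N, p n = (N / q : ℕ) * S + ∑ x ∈ Finset.range (N % q), l x := by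
      conv_lhs => rw [← Nat.div_add_mod N q]
      rw [Finset.sum_range_add, hblock]
      congr 1
      refine Finset.sum_congr rfl fun x hx => ?_
      simp [hp, Nat.mod_eq_of_lt ((Finset.mem_range.1 hx).trans hlt)]
    have e2 : (N : ℂ) = q * (N / q : ℕ) + (N % q : ℕ) := by
      exact_mod_cast (Nat.div_add_mod N q).symm
    have e3 : ∑ n ∈ Finset.range N, p n - (N : ℂ) * ((q : ℂ)⁻¹ * S)
        = ∑ x ∈ Finset.range (N % q), l x - ((N % q : ℕ) / q : ℂ) * S := by
      rw [e]
      conv_lhs => rw [e2]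
      field_simp
      ring
    rw [e3]
    have b1 : ‖∑ x ∈ Finset.range (N % q), l x‖ ≤ B :=
      (norm_sum_le _ _).trans (Finset.sum_le_sum_of_subset_of_nonneg
        (Finset.range_mono hlt.le) fun _ _ _ => norm_nonneg _)
    have b2 : ‖((N % q : ℕ) / q : ℂ) * S‖ ≤ B := by
      rw [norm_mul]
      have : ‖((N % q : ℕ) / q : ℂ)‖ ≤ 1 := by
        rw [norm_div, Complex.norm_natCast, Complex.norm_natCast,
          div_le_one (by exact_mod_cast hq)]
        exact_mod_cast hlt.le
      calc _ ≤ 1 * B := mul_le_mul this (norm_sum_le _ _) (norm_nonneg _) zero_le_one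
        _ = B := one_mul _
    calc _ ≤ _ := norm_sub_le _ _
      _ ≤ 2 * B := by linarith
  have h3 : Tendsto (fun N : ℕ => (N : ℂ)⁻¹ *
      (∑ n ∈ Finset.range N, p n - (N : ℂ) * ((q : ℂ)⁻¹ * S))) atTop (𝓝 0) := by
    refine squeeze_zero_norm (a := fun N : ℕ => (N : ℝ)⁻¹ * (2 * B)) (fun N => ?_) ?_
    · rw [norm_mul, norm_inv, Complex.norm_natCast]
      exact mul_le_mul_of_nonneg_left (h2 N) (by positivity)
    · simpa using (tendsto_inv_atTop_nhds_zero_nat (𝕜 := ℝ)).mul_const (2 * B)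
  have h4 := (h1.add h3).add_const ((q : ℂ)⁻¹ * S)
  simp only [zero_add] at h4
  refine h4.congr' ?_
  filter_upwards [eventually_gt_atTop 0] with N hN
  have : (N : ℂ) ≠ 0 := by exact_mod_cast hN.ne'
  rw [Complex.real_smul, Finset.sum_sub_distrib]
  push_cast
  field_simp
  ring

/-! ### Diagonal entries of powers -/

variable (α : ℕ → UnitDisc) (lam : ℕ → Circle)

/-- The diagonal matrix element `⟨δ_n, 𝒞 ^ k δ_n⟩`. -/
def diagPow (k n : ℕ) : ℂ := (seqC α lam)^[k] (Pi.single n 1) n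

lemma coe_delta (n : ℕ) : (delta n : ℕ → ℂ) = Pi.single n 1 :=
  lp.coeFn_single _ _ _

lemma inner_delta (n : ℕ) (f : Ell2) : ⟪delta n, f⟫_ℂ = f n := by
  simp [delta, lp.inner_single_left]

lemma norm_delta (n : ℕ) : ‖delta n‖ = 1 := by
  simp [delta, lp.norm_single]

lemma coe_cmv_pow_apply (k : ℕ) (f : Ell2) :
    (((cmv α lam : Ell2 →L[ℂ] Ell2) ^ k) f : ℕ → ℂ) = (seqC α lam)^[k] f := by
  induction k with
  | zero => rfl
  | succ k ih =>
    rw [pow_succ', Function.iterate_succ_apply', ← ih]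
    rfl

lemma inner_cmv_pow (k n : ℕ) :
    ⟪delta n, ((cmv α lam : Ell2 →L[ℂ] Ell2) ^ k) (delta n)⟫_ℂ = diagPow α lam k n := by
  rw [inner_delta, coe_cmv_pow_apply, coe_delta, diagPow]

/-- The action of the truncated CMV matrix on sequences. -/
def cutC (N : ℕ) (f : ℕ → ℂ) : ℕ → ℂ := fun n => if n < N then seqC α lam f n else 0

lemma hasSum_single_sq (n : ℕ) :
    HasSum (fun m => ‖(Pi.single n 1 : ℕ → ℂ) m‖ ^ 2) 1 := by
  convert hasSum_ite_eq n (1 : ℝ) using 2 with m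
  by_cases h : m = n <;> simp [h]

lemma norm_le_one_of_hasSum {f : ℕ → ℂ} {b : ℝ} (hf : HasSum (fun n => ‖f n‖ ^ 2) b) (hb : b ≤ 1)
    (n : ℕ) : ‖f n‖ ≤ 1 := by
  have := (le_hasSum hf n fun _ _ => sq_nonneg _).trans hb
  exact (sq_le_one_iff₀ (norm_nonneg _)).1 this

/-- The truncation is a unitary followed by a cut-off, hence a contraction. This bounds its entries
uniformly in `N`, so boundary terms vanish in the averages. -/
lemma hasSum_cutC_iterate (N n k : ℕ) :
    ∃ b ≤ (1 : ℝ), HasSum (fun m => ‖(cutC α lam N)^[k] (Pi.single n 1) m‖ ^ 2) b := by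
  induction k with
  | zero => exact ⟨1, le_rfl, hasSum_single_sq n⟩
  | succ k ih =>
    obtain ⟨b, hb, h⟩ := ih
    have h1 := hasSum_seqC α lam _ _ h
    have hle : ∀ m, ‖cutC α lam N ((cutC α lam N)^[k] (Pi.single n 1)) m‖ ^ 2
        ≤ ‖seqC α lam ((cutC α lam N)^[k] (Pi.single n 1)) m‖ ^ 2 := by
      intro m
      unfold cutC
      split_ifs
      · exact le_rfl
      · simp
    have hs := Summable.of_nonneg_of_le (fun _ => sq_nonneg _) hle h1.summable
    simp only [Function.iterate_succ_apply']
    exact ⟨_, (hasSum_le hle hs.hasSum h1).trans hb, hs.hasSum⟩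

lemma norm_diagPow_le (k n : ℕ) : ‖diagPow α lam k n‖ ≤ 1 := by
  have : HasSum (fun m => ‖(seqC α lam)^[k] (Pi.single n 1) m‖ ^ 2) 1 := by
    induction k with
    | zero => exact hasSum_single_sq n
    | succ k ih =>
      simp only [Function.iterate_succ_apply']
      exact hasSum_seqC α lam _ _ ih
  exact norm_le_one_of_hasSum this le_rfl n

/-- With bandwidth two, `k` applications see only sites within distance `2k`, so the cut at `N` is
not felt. -/
lemma cutC_iterate_eq (N k : ℕ) : ∀ (n : ℕ) (f f' : ℕ → ℂ), n + 2 * k < N →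
    (∀ m, m ≤ n + 2 * k → n ≤ m + 2 * k → f m = f' m) →
    (cutC α lam N)^[k] f n = (seqC α lam)^[k] f' n := by
  induction k with
  | zero => intro n f f' _ h; exact h n (by omega) (by omega)
  | succ k ih =>
    intro n f f' hN h
    simp only [Function.iterate_succ_apply]
    refine ih n _ _ (by omega) fun m h1 h2 => ?_
    rw [cutC, if_pos (by omega)]
    exact seqC_congr α lam fun l h3 h4 => h l (by omega) (by omega)

lemma seqC_iterate_shift {q : ℕ} (hq : Even q) (hα : ∀ n, α (n + q) = α n)
    (hlam : ∀ n, lam (n + q) = lam n) (k : ℕ) : ∀ (n : ℕ) (f f' : ℕ → ℂ), 2 * k ≤ n →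
    (∀ m, m ≤ n + 2 * k → n ≤ m + 2 * k → f' (m + q) = f m) →
    (seqC α lam)^[k] f' (n + q) = (seqC α lam)^[k] f n := by
  induction k with
  | zero => intro n f f' _ h; exact h n (by omega) (by omega)
  | succ k ih =>
    intro n f f' hN h
    simp only [Function.iterate_succ_apply]
    refine ih n _ _ (by omega) fun m h1 h2 => ?_
    exact seqC_shift α lam hq hα hlam (by omega) fun l h3 h4 => h l (by omega) (by omega)

lemma diagPow_add {q : ℕ} (hq : Even q) (hα : ∀ n, α (n + q) = α n)
    (hlam : ∀ n, lam (n + q) = lam n) {k n : ℕ} (hn : 2 * k ≤ n) :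
    diagPow α lam k (n + q) = diagPow α lam k n := by
  refine seqC_iterate_shift α lam hq hα hlam k n _ _ hn fun m _ _ => ?_
  by_cases h : m = n
  · simp [h]
  · rw [Pi.single_eq_of_ne h, Pi.single_eq_of_ne (by omega)]

lemma exists_tendsto_average_diagPow {q : ℕ} (hq0 : 0 < q) (hq : Even q)
    (hα : ∀ n, α (n + q) = α n) (hlam : ∀ n, lam (n + q) = lam n) (k : ℕ) :
    ∃ l, Tendsto (fun N : ℕ => (N : ℂ)⁻¹ * ∑ n ∈ Finset.range N, diagPow α lam k n) atTop
      (𝓝 l) := by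
  -- The representative `r + q * (2 * k)` is at least `2 * k`, from where on the entry is constant
  -- along the residue class.
  refine ⟨_, tendsto_average_of_residues hq0 (l := fun r => diagPow α lam k (r + q * (2 * k)))
    fun r _ => ?_⟩
  refine tendsto_const_nhds.congr' ?_
  filter_upwards [eventually_ge_atTop (2 * k)] with m hm
  induction m, hm using Nat.le_induction with
  | base => rfl
  | succ m hm ih =>
    rw [ih, Nat.mul_succ, ← Nat.add_assoc, diagPow_add α lam hq hα hlam]
    nlinarith

/-! ### Traces of powers of truncations -/

lemma cutC_iterate_support {N n k m : ℕ} (hn : n < N) (hm : N ≤ m) :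
    (cutC α lam N)^[k] (Pi.single n 1) m = 0 := by
  cases k with
  | zero => simp [Pi.single_eq_of_ne (show m ≠ n by omega)]
  | succ k => rw [Function.iterate_succ_apply', cutC, if_neg (by omega)]

lemma truncation_pow_apply (N k : ℕ) (i j : Fin N) :
    (truncation (cmv α lam) N ^ k) i j = (cutC α lam N)^[k] (Pi.single (j : ℕ) 1) i := by
  induction k generalizing i with
  | zero => simp [Matrix.one_apply, Pi.single_apply, Fin.ext_iff]
  | succ k ih =>
    rw [pow_succ', Matrix.mul_apply, Function.iterate_succ_apply', cutC, if_pos i.2]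
    set f := (cutC α lam N)^[k] (Pi.single (j : ℕ) 1) with hf
    have hsum : f = ∑ l : Fin N, f l • (Pi.single (l : ℕ) 1 : ℕ → ℂ) := by
      ext m
      rw [Finset.sum_apply]
      by_cases hm : m < N
      · rw [Finset.sum_eq_single (⟨m, hm⟩ : Fin N)]
        · simp
        · intro b _ hb
          rw [Pi.smul_apply, Pi.single_eq_of_ne fun h => hb (Fin.ext h.symm)]
          simp
        · simp
      · rw [hf, cutC_iterate_support α lam j.2 (by omega)]
        refine (Finset.sum_eq_zero fun b _ => ?_).symm
        rw [Pi.smul_apply, Pi.single_eq_of_ne (by omega)]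
        simp
    rw [hsum, map_sum, Finset.sum_apply]
    refine Finset.sum_congr rfl fun l _ => ?_
    rw [ih, map_smul, Pi.smul_apply, smul_eq_mul, mul_comm, truncation, Matrix.of_apply,
      inner_delta, coe_cmv_apply, coe_delta]

/-- At most the last `2k` sites feel the cut, and two numbers of modulus at most `1` differ by at
most `2`. The bound does not depend on `N`. -/
lemma norm_sum_diagPow_sub_trace_le (N k : ℕ) :
    ‖∑ n ∈ Finset.range N, diagPow α lam k n - (truncation (cmv α lam) N ^ k).trace‖ ≤ 4 * k := by
  have e : (truncation (cmv α lam) N ^ k).trace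
      = ∑ n ∈ Finset.range N, (cutC α lam N)^[k] (Pi.single n 1) n := by
    rw [Matrix.trace, Finset.sum_range]
    exact Finset.sum_congr rfl fun i _ => truncation_pow_apply α lam N k i i
  rw [e, ← Finset.sum_sub_distrib]
  have h0 : ∀ n ∈ Finset.range N, n ∉ Finset.Ico (N - 2 * k) N →
      diagPow α lam k n - (cutC α lam N)^[k] (Pi.single n 1) n = 0 := by
    intro n hn h
    rw [Finset.mem_range] at hn
    rw [Finset.mem_Ico] at h
    rw [cutC_iterate_eq α lam N k n _ (Pi.single n 1) (by omega) fun _ _ _ => rfl]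
    exact sub_self _
  rw [← Finset.sum_subset (s₁ := Finset.Ico (N - 2 * k) N) (fun n hn => by
    rw [Finset.mem_Ico] at hn; exact Finset.mem_range.2 hn.2) h0]
  have hb : ∀ n ∈ Finset.Ico (N - 2 * k) N,
      ‖diagPow α lam k n - (cutC α lam N)^[k] (Pi.single n 1) n‖ ≤ 2 := by
    intro n _
    obtain ⟨b, hb, h⟩ := hasSum_cutC_iterate α lam N n k
    have := norm_le_one_of_hasSum h hb n
    have := norm_diagPow_le α lam k n
    exact (norm_sub_le _ _).trans (by linarith)
  refine (norm_sum_le_of_le _ hb).trans ?_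
  rw [Finset.sum_const, Nat.card_Ico, nsmul_eq_mul]
  have : ((N - (N - 2 * k) : ℕ) : ℝ) ≤ 2 * k := by exact_mod_cast (by omega)
  linarith

/-- The moments of the eigenvalue counting measures of the truncations are asymptotically the
averages of the diagonal matrix elements of the powers of the CMV matrix. -/
lemma tendsto_moments_iff (k : ℕ) (l : ℂ) :
    Tendsto (fun N : ℕ => ∫ z, z ^ k ∂(countingMeasure (truncation (cmv α lam) N))) atTop (𝓝 l) ↔
    Tendsto (fun N : ℕ => (N : ℂ)⁻¹ * ∑ n ∈ Finset.range N, diagPow α lam k n) atTop (𝓝 l) := by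
  have h : Tendsto (fun N : ℕ => (N : ℂ)⁻¹ * ∑ n ∈ Finset.range N, diagPow α lam k n
      - ∫ z, z ^ k ∂(countingMeasure (truncation (cmv α lam) N))) atTop (𝓝 0) := by
    refine squeeze_zero_norm (a := fun N : ℕ => (N : ℝ)⁻¹ * (4 * k)) (fun N => ?_) ?_
    · rw [integral_pow_countingMeasure, ← mul_sub, norm_mul, norm_inv, Complex.norm_natCast]
      exact mul_le_mul_of_nonneg_left (norm_sum_diagPow_sub_trace_le α lam N k) (by positivity)
    · simpa using (tendsto_inv_atTop_nhds_zero_nat (𝕜 := ℝ)).mul_const (4 * (k : ℝ))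
  constructor
  · intro h1
    simpa using h.add h1
  · intro h1
    simpa using h1.sub h

end CMV
end

noncomputable section
namespace CMV

/-! ### Moments of spectral measures -/

section Spectral

variable {H : Type*} [NormedAddCommGroup H] [InnerProductSpace ℂ H] [CompleteSpace H]

/-- The functional was defined through a real part; nothing is lost, because `f(T)` is self-adjoint
for real `f`. -/
lemma integral_ofReal_rieszMeasure (T : H →L[ℂ] H) (hT : IsStarNormal T) (v : H)
    (f : C(spectrum ℂ T, ℝ)) :
    ((∫ x, f x ∂(RealRMK.rieszMeasure (spectralFunctional T hT v)) : ℝ) : ℂ) =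
      ⟪v, cfcHom hT (⟨fun x => (f x : ℂ), by fun_prop⟩ : C(spectrum ℂ T, ℂ)) v⟫_ℂ := by
  set g : C(spectrum ℂ T, ℂ) := ⟨fun x => (f x : ℂ), by fun_prop⟩ with hg
  have h1 : ∫ x, f x ∂(RealRMK.rieszMeasure (spectralFunctional T hT v))
      = (⟪v, cfcHom hT g v⟫_ℂ).re :=
    RealRMK.integral_rieszMeasure (spectralFunctional T hT v)
      (⟨f, HasCompactSupport.of_compactSpace f⟩ : C_c(spectrum ℂ T, ℝ))
  have h2 : star g = g := by
    ext x
    simp [hg]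
  have h3 : conj (⟪v, cfcHom hT g v⟫_ℂ) = ⟪v, cfcHom hT g v⟫_ℂ := by
    rw [inner_conj_symm, ← ContinuousLinearMap.adjoint_inner_right,
      ← ContinuousLinearMap.star_eq_adjoint, ← map_star, h2]
  rw [h1]
  exact Complex.conj_eq_iff_re.1 h3

lemma integral_rieszMeasure_cfcHom (T : H →L[ℂ] H) (hT : IsStarNormal T) (v : H)
    (g : C(spectrum ℂ T, ℂ)) :
    ∫ x, g x ∂(RealRMK.rieszMeasure (spectralFunctional T hT v)) = ⟪v, cfcHom hT g v⟫_ℂ := by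
  set μ := RealRMK.rieszMeasure (spectralFunctional T hT v)
  let a : C(spectrum ℂ T, ℝ) := ⟨fun x => (g x).re, by fun_prop⟩
  let b : C(spectrum ℂ T, ℝ) := ⟨fun x => (g x).im, by fun_prop⟩
  have hi : ∀ f : C(spectrum ℂ T, ℂ), Integrable f μ := fun f =>
    f.continuous.integrable_of_hasCompactSupport (HasCompactSupport.of_compactSpace f)
  have e : g = (⟨fun x => (a x : ℂ), by fun_prop⟩ : C(spectrum ℂ T, ℂ))
      + I • (⟨fun x => (b x : ℂ), by fun_prop⟩ : C(spectrum ℂ T, ℂ)) := by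
    ext x
    simp [a, b, mul_comm I, Complex.re_add_im]
  have e2 : ∫ x, g x ∂μ = (∫ x, (a x : ℂ) ∂μ) + I * ∫ x, (b x : ℂ) ∂μ := by
    have ha : Integrable (fun x => (a x : ℂ)) μ := hi ⟨fun x => (a x : ℂ), by fun_prop⟩
    have hb : Integrable (fun x => (b x : ℂ)) μ := hi ⟨fun x => (b x : ℂ), by fun_prop⟩
    rw [← integral_const_mul, ← integral_add ha (hb.const_mul I)]
    congr 1
    ext x
    simp [a, b, mul_comm I, Complex.re_add_im]
  rw [e2, integral_complex_ofReal, integral_complex_ofReal, integral_ofReal_rieszMeasure,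
    integral_ofReal_rieszMeasure, e, map_add, map_smul, add_apply, smul_apply, inner_add_right,
    inner_smul_right]

lemma integral_pow_rieszMeasure (T : H →L[ℂ] H) (hT : IsStarNormal T) (v : H) (k : ℕ) :
    ∫ x, (x : ℂ) ^ k ∂(RealRMK.rieszMeasure (spectralFunctional T hT v)) = ⟪v, (T ^ k) v⟫_ℂ := by
  have := integral_rieszMeasure_cfcHom T hT v ((ContinuousMap.restrict (spectrum ℂ T)
    (ContinuousMap.id ℂ)) ^ k)
  rw [map_pow, cfcHom_id] at this
  simpa using this

lemma isProbabilityMeasure_rieszMeasure (T : H →L[ℂ] H) (hT : IsStarNormal T) (v : H)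
    (hv : ‖v‖ = 1) : IsProbabilityMeasure (RealRMK.rieszMeasure (spectralFunctional T hT v)) := by
  have := integral_pow_rieszMeasure T hT v 0
  simp only [pow_zero, one_apply_eq_self, integral_const, inner_self_eq_norm_sq_to_K,
    hv] at this
  rw [isProbabilityMeasure_iff_real]
  simpa using this

lemma map_val_compl_sphere {T : H →L[ℂ] H} (hu : T ∈ unitary (H →L[ℂ] H))
    (μ : Measure (spectrum ℂ T)) : (μ.map Subtype.val) (Metric.sphere (0 : ℂ) 1)ᶜ = 0 := by
  rw [Measure.map_apply measurable_subtype_coe Metric.isClosed_sphere.measurableSet.compl]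
  convert measure_empty (μ := μ)
  ext x
  simpa using spectrum.subset_circle_of_unitary hu x.2

end Spectral

lemma integral_pow_map_val {X : Set ℂ} (μ : Measure X) (k : ℕ) :
    ∫ z, z ^ k ∂(μ.map Subtype.val) = ∫ x, (x : ℂ) ^ k ∂μ :=
  integral_map measurable_subtype_coe.aemeasurable (by fun_prop)

lemma integrable_herglotz {μ : Measure ℂ} [IsFiniteMeasure μ] (hae : ∀ᵐ w ∂μ, ‖w‖ = 1) {z : ℂ}
    (hz : ‖z‖ < 1) : Integrable (fun w => (w + z) / (w - z)) μ := by
  refine Integrable.of_bound (Measurable.aestronglyMeasurable (by fun_prop))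
    ((1 + ‖z‖) / (1 - ‖z‖)) ?_
  filter_upwards [hae] with w hw
  rw [norm_div]
  have h5 : 1 - ‖z‖ ≤ ‖w - z‖ := by rw [← hw]; exact norm_sub_norm_le w z
  have h6 : ‖w + z‖ ≤ 1 + ‖z‖ := by rw [← hw]; exact norm_add_le w z
  have : 0 < 1 - ‖z‖ := by linarith
  gcongr

lemma ae_norm_eq_one {μ : Measure ℂ} (hμ : μ (Metric.sphere (0 : ℂ) 1)ᶜ = 0) :
    ∀ᵐ w ∂μ, ‖w‖ = 1 := by
  rw [ae_iff]
  convert hμ using 2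
  ext w
  simp

/-- The Herglotz integral of a probability measure on the circle in terms of its moments. -/
lemma hasSum_herglotz (μ : Measure ℂ) [IsProbabilityMeasure μ]
    (hμ : μ (Metric.sphere (0 : ℂ) 1)ᶜ = 0) {z : ℂ} (hz : ‖z‖ < 1) :
    HasSum (fun k : ℕ => 2 * z ^ (k + 1) * conj (∫ w, w ^ (k + 1) ∂μ))
      (∫ w, (w + z) / (w - z) ∂μ - 1) := by
  have hae := ae_norm_eq_one hμ
  -- On the circle `w⁻¹ = conj w`, so this is the geometric expansion of `(w + z) / (w - z) - 1` in
  -- powers of `z / w`.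
  set F : ℕ → ℂ → ℂ := fun k w => 2 * z ^ (k + 1) * conj (w ^ (k + 1)) with hF
  have hFn : ∀ k, ∀ᵐ w ∂μ, ‖F k w‖ = 2 * ‖z‖ ^ (k + 1) := by
    intro k
    filter_upwards [hae] with w hw
    simp [hF, hw]
  have hFi : ∀ k, Integrable (F k) μ := fun k =>
    Integrable.of_bound (by fun_prop) (2 * ‖z‖ ^ (k + 1)) ((hFn k).mono fun w hw => hw.le)
  have h := hasSum_integral_of_summable_integral_norm hFi (by
    have : ∀ k, ∫ w, ‖F k w‖ ∂μ = 2 * ‖z‖ ^ (k + 1) := fun k => by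
      rw [integral_congr_ae (hFn k)]; simp
    simp only [this]
    exact ((summable_nat_add_iff 1).2 (summable_geometric_of_lt_one (norm_nonneg z) hz)).mul_left 2)
  have e1 : ∀ k, ∫ w, F k w ∂μ = 2 * z ^ (k + 1) * conj (∫ w, w ^ (k + 1) ∂μ) := fun k => by
    rw [integral_const_mul, integral_conj]
  have hne : ∀ w : ℂ, ‖w‖ = 1 → w - z ≠ 0 := fun w hw h0 => by
    rw [sub_eq_zero] at h0
    rw [h0] at hw
    linarith
  have e2 : ∀ᵐ w ∂μ, ∑' k, F k w = (w + z) / (w - z) - 1 := by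
    filter_upwards [hae] with w hw
    have hw0 : w ≠ 0 := fun h0 => by simp [h0] at hw
    have hc : conj w = w⁻¹ := by
      rw [Complex.inv_def, Complex.normSq_eq_norm_sq, hw]; simp
    have hr : ‖z * w⁻¹‖ < 1 := by rw [norm_mul, norm_inv, hw]; simpa using hz
    have h1 := ((hasSum_geometric_of_norm_lt_one hr).mul_left (2 * (z * w⁻¹))).tsum_eq
    have h2 : ∀ k, F k w = 2 * (z * w⁻¹) * (z * w⁻¹) ^ k := fun k => by
      simp only [hF, map_pow, hc]; ring
    simp only [h2]
    rw [h1]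
    have h3 := hne w hw
    have h4 : 1 - z * w⁻¹ = (w - z) / w := by field_simp
    rw [h4]
    field_simp
    ring
  have hint := integrable_herglotz hae hz
  rw [integral_congr_ae e2, integral_sub hint (integrable_const 1)] at h
  simpa [e1] using h

variable (α : ℕ → UnitDisc) (lam : ℕ → Circle)

lemma isProbabilityMeasure_cmvMeasure : IsProbabilityMeasure (cmvMeasure α lam) := by
  have := isProbabilityMeasure_rieszMeasure _ (isStarNormal_cmv α lam) (delta 0) (norm_delta 0)
  exact Measure.isProbabilityMeasure_map measurable_subtype_coe.aemeasurable

lemma cmvMeasure_compl_sphere : cmvMeasure α lam (Metric.sphere (0 : ℂ) 1)ᶜ = 0 :=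
  map_val_compl_sphere (cmv α lam).2 _

lemma integral_pow_cmvMeasure (k : ℕ) : ∫ w, w ^ k ∂(cmvMeasure α lam) = diagPow α lam k 0 := by
  rw [cmvMeasure, spectralMeasure, integral_pow_map_val, integral_pow_rieszMeasure, inner_cmv_pow]

lemma hasSum_caratheodory {z : ℂ} (hz : ‖z‖ < 1) :
    HasSum (fun k : ℕ => 2 * z ^ (k + 1) * conj (diagPow α lam (k + 1) 0))
      (caratheodory α lam z - 1) := by
  have := isProbabilityMeasure_cmvMeasure α lam
  have h := hasSum_herglotz (cmvMeasure α lam) (cmvMeasure_compl_sphere α lam) hz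
  simp only [integral_pow_cmvMeasure] at h
  exact h

/-- The density of states measure exists: it is a limit of averaged spectral measures. -/
lemma exists_isDensityOfStates {q : ℕ} (hq0 : 0 < q) (hq : Even q)
    (hα : ∀ n, α (n + q) = α n) (hlam : ∀ n, lam (n + q) = lam n) :
    ∃ ν : Measure ℂ, IsDensityOfStates (cmv α lam) ν := by
  set T : Ell2 →L[ℂ] Ell2 := (cmv α lam : Ell2 →L[ℂ] Ell2) with hT
  set X := spectrum ℂ T
  have : CompactSpace X := isCompact_iff_compactSpace.1 (spectrum.isCompact T)
  let ρ : ℕ → Measure X := fun n =>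
    RealRMK.rieszMeasure (spectralFunctional T (isStarNormal_cmv α lam) (delta n))
  have hρ : ∀ n, IsProbabilityMeasure (ρ n) := fun n =>
    isProbabilityMeasure_rieszMeasure T _ (delta n) (norm_delta n)
  let A : ℕ → Measure X := fun N => ((N + 1 : ℕ) : ENNReal)⁻¹ • ∑ n ∈ Finset.range (N + 1), ρ n
  have hA : ∀ N, IsProbabilityMeasure (A N) := fun N => ⟨by
    simp only [A, Measure.smul_apply, Measure.finsetSum_apply, measure_univ, Finset.sum_const,
      Finset.card_range, nsmul_eq_mul, mul_one, smul_eq_mul]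
    exact ENNReal.inv_mul_cancel (by simp) (by simp)⟩
  have hρint : ∀ n k, ∫ x, (x : ℂ) ^ k ∂(ρ n) = diagPow α lam k n := fun n k =>
    (integral_pow_rieszMeasure T (isStarNormal_cmv α lam) (delta n) k).trans (inner_cmv_pow α lam k n)
  have hAint : ∀ N k, ∫ x, (x : ℂ) ^ k ∂(A N) =
      ((N + 1 : ℕ) : ℂ)⁻¹ * ∑ n ∈ Finset.range (N + 1), diagPow α lam k n := by
    intro N k
    rw [integral_smul_measure, integral_finsetSum_measure]
    · simp only [hρint]
      rw [ENNReal.toReal_inv, ENNReal.toReal_natCast, Complex.real_smul, Complex.ofReal_inv,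
        Complex.ofReal_natCast]
    · intro n _
      exact Continuous.integrable_of_hasCompactSupport (by fun_prop)
        (HasCompactSupport.of_compactSpace _)
  let μ : ℕ → ProbabilityMeasure X := fun N => ⟨A N, hA N⟩
  -- A limit along one ultrafilter suffices: the moments of the averages converge along the full
  -- sequence, so their limits must be the moments of this `ν`.
  obtain ⟨ν, -, hν⟩ := isCompact_univ.ultrafilter_le_nhds ((Ultrafilter.of atTop).map μ) (by simp)
  have hν' : Tendsto μ (Ultrafilter.of (atTop : Filter ℕ)) (𝓝 ν) := hν
  refine ⟨(ν : Measure X).map Subtype.val,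
    Measure.isProbabilityMeasure_map measurable_subtype_coe.aemeasurable,
    map_val_compl_sphere (cmv α lam).2 _, fun k => ?_⟩
  rw [tendsto_moments_iff, integral_pow_map_val]
  obtain ⟨l, hl⟩ := exists_tendsto_average_diagPow α lam hq0 hq hα hlam k
  have h1 := (ProbabilityMeasure.tendsto_iff_forall_integral_rclike_tendsto ℂ).1 hν'
    (BoundedContinuousFunction.mkOfCompact ⟨fun x : X => (x : ℂ) ^ k, by fun_prop⟩)
  have h2 := (hl.comp (tendsto_add_atTop_nat 1)).mono_left (Ultrafilter.of_le (atTop : Filter ℕ))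
  have h3 : Tendsto (fun N => ∫ x, (x : ℂ) ^ k ∂(A N)) (Ultrafilter.of (atTop : Filter ℕ)) (𝓝 l) := by
    simp only [hAint]
    exact h2
  have : l = ∫ x, (x : ℂ) ^ k ∂(ν : Measure X) := tendsto_nhds_unique h3 h1
  rwa [← this]

end CMV
end

noncomputable section
namespace CMV

/-! ### Boundary values of Poisson integrals -/

/-- The integral over the arc from `a` to `b` of the Poisson kernel `Re ((w + z) / (w - z))` along
`|z| = r`. -/
def arcKernel (a b r : ℝ) (w : ℂ) : ℝ :=
  (b - a) - 2 * arg (1 - r * exp (b * I) * conj w) + 2 * arg (1 - r * exp (a * I) * conj w)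

lemma norm_exp_conj {w : ℂ} (hw : ‖w‖ = 1) (t : ℝ) : ‖exp (t * I) * conj w‖ = 1 := by
  rw [norm_mul, norm_exp_ofReal_mul_I, RCLike.norm_conj, hw, one_mul]

lemma one_sub_mem_slitPlane {w : ℂ} (hw : ‖w‖ = 1) {r : ℝ} (hr : |r| < 1) (t : ℝ) :
    1 - r * exp (t * I) * conj w ∈ slitPlane := by
  refine Or.inl ?_
  have h1 : ‖(r : ℂ) * exp (t * I) * conj w‖ = |r| := by
    rw [mul_assoc, norm_mul, norm_exp_conj hw]; simp
  have h2 := (re_le_norm ((r : ℂ) * exp (t * I) * conj w)).trans_eq h1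
  rw [sub_re, one_re]
  linarith

/-- A primitive is the real part of `t + 2i log (1 - r e^{it} conj w)`; the principal branch is
smooth there because the argument of the logarithm has positive real part. -/
lemma integral_poisson_arc {w : ℂ} (hw : ‖w‖ = 1) {r : ℝ} (hr : |r| < 1) (a b : ℝ) :
    ∫ t in a..b, ((w + r * exp (t * I)) / (w - r * exp (t * I))).re = arcKernel a b r w := by
  have hw0 : w ≠ 0 := fun h0 => by simp [h0] at hw
  have hc : conj w = w⁻¹ := by
    rw [Complex.inv_def, Complex.normSq_eq_norm_sq, hw]; simp
  have hne : ∀ t : ℝ, w - r * exp (t * I) ≠ 0 := fun t h0 => by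
    have := slitPlane_ne_zero (one_sub_mem_slitPlane hw hr t)
    rw [sub_eq_zero] at h0
    rw [← h0, hc, mul_inv_cancel₀ hw0, sub_self] at this
    exact this rfl
  have hd : ∀ t : ℝ, HasDerivAt
      (fun t : ℝ => ((t : ℂ) + 2 * I * log (1 - r * exp (t * I) * conj w)).re)
      ((w + r * exp (t * I)) / (w - r * exp (t * I))).re t := by
    intro t
    have h1 : HasDerivAt (fun t : ℝ => exp ((t : ℂ) * I)) (exp (t * I) * I) t := by
      simpa using (((hasDerivAt_id (t : ℂ)).mul_const I).cexp).comp_ofReal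
    have h2 := (((h1.const_mul (r : ℂ)).mul_const (conj w)).const_sub 1).clog_real
      (one_sub_mem_slitPlane hw hr t)
    have h3 := ((hasDerivAt_id (t : ℂ)).comp_ofReal).add (h2.const_mul (2 * I))
    have h4 := reCLM.hasFDerivAt.comp_hasDerivAt t h3
    refine h4.congr_deriv ?_
    have h5 : 1 - r * exp (t * I) * w⁻¹ = (w - r * exp (t * I)) / w := by field_simp
    have h6 := hne t
    change (1 + _ : ℂ).re = _
    rw [hc, h5]
    congr 1
    generalize exp (t * I) = E at h6
    field_simp
    linear_combination (-2 * r * E) * I_sq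
  have hcont : Continuous fun t : ℝ => ((w + r * exp (t * I)) / (w - r * exp (t * I))).re :=
    Complex.continuous_re.comp (Continuous.div (by fun_prop) (by fun_prop) hne)
  rw [intervalIntegral.integral_eq_sub_of_hasDerivAt (fun t _ => hd t)
    (hcont.intervalIntegrable a b)]
  simp [arcKernel, Complex.log_im, mul_assoc]
  ring

/-- Half-angle factorization: `1 - e^{iφ} = 2 sin (φ/2) e^{i(φ - π)/2}`. -/
lemma arg_one_sub_exp {φ : ℝ} (h0 : 0 < φ) (h1 : φ < 2 * Real.pi) :
    arg (1 - exp (φ * I)) = (φ - Real.pi) / 2 := by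
  have hs : 0 < 2 * Real.sin (φ / 2) :=
    mul_pos two_pos (Real.sin_pos_of_pos_of_lt_pi (by linarith) (by linarith))
  have e : 1 - exp (φ * I) = ((2 * Real.sin (φ / 2) : ℝ) : ℂ) *
      (Complex.cos (((φ - Real.pi) / 2 : ℝ) : ℂ) + Complex.sin (((φ - Real.pi) / 2 : ℝ) : ℂ) * I) := by
    have h2 : (φ - Real.pi) / 2 = φ / 2 - Real.pi / 2 := by ring
    rw [h2, ← Complex.ofReal_cos, ← Complex.ofReal_sin, Real.cos_sub_pi_div_two,
      Real.sin_sub_pi_div_two, Complex.exp_mul_I, ← Complex.ofReal_cos, ← Complex.ofReal_sin]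
    have h3 : Real.cos φ = 1 - 2 * Real.sin (φ / 2) ^ 2 := by
      have := Real.cos_two_mul' (φ / 2)
      rw [show 2 * (φ / 2) = φ by ring] at this
      have := Real.sin_sq_add_cos_sq (φ / 2)
      linarith
    have h4 : Real.sin φ = 2 * Real.sin (φ / 2) * Real.cos (φ / 2) := by
      rw [← Real.sin_two_mul]; ring_nf
    rw [h3, h4]
    push_cast
    ring
  rw [e, Complex.arg_mul_cos_add_sin_mul_I hs ⟨by linarith, by linarith⟩]

lemma exp_mul_conj_exp (t s : ℝ) : exp (t * I) * conj (exp (s * I)) = exp ((t - s : ℝ) * I) := by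
  rw [← Complex.exp_conj, ← Complex.exp_add]
  congr 1
  simp
  ring

lemma arcKernel_one_of_mem_Ioo {a b s : ℝ} (hb : b < a + 2 * Real.pi) (hs : s ∈ Ioo a b) :
    arcKernel a b 1 (exp (s * I)) = 2 * Real.pi := by
  obtain ⟨h1, h2⟩ := hs
  have e : exp ((a - s : ℝ) * I) = exp ((a - s + 2 * Real.pi : ℝ) * I) := by
    rw [Complex.ofReal_add, add_mul, Complex.exp_add]; simp
  simp only [arcKernel, ofReal_one, one_mul, exp_mul_conj_exp]
  rw [e, arg_one_sub_exp (by linarith) (by linarith), arg_one_sub_exp (by linarith) (by linarith)]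
  ring

lemma arcKernel_one_of_mem_Ioo' {a b s : ℝ} (hab : a ≤ b) (hs : s ∈ Ioo (b - 2 * Real.pi) a) :
    arcKernel a b 1 (exp (s * I)) = 0 := by
  obtain ⟨h1, h2⟩ := hs
  simp only [arcKernel, ofReal_one, one_mul, exp_mul_conj_exp]
  rw [arg_one_sub_exp (by linarith) (by linarith), arg_one_sub_exp (by linarith) (by linarith)]
  ring

/-- The endpoint gets half the weight because `arg 0 = 0`, which is also the radial limit of `arg (1
- r)`. -/
lemma arcKernel_one_left {a b : ℝ} (hab : a < b) (hb : b < a + 2 * Real.pi) :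
    arcKernel a b 1 (exp (a * I)) = Real.pi := by
  simp only [arcKernel, ofReal_one, one_mul, exp_mul_conj_exp]
  rw [arg_one_sub_exp (by linarith) (by linarith), sub_self]
  simp
  ring

lemma arcKernel_one_right {a b : ℝ} (hab : a < b) (hb : b < a + 2 * Real.pi) :
    arcKernel a b 1 (exp (b * I)) = Real.pi := by
  have e : exp ((a - b : ℝ) * I) = exp ((a - b + 2 * Real.pi : ℝ) * I) := by
    rw [Complex.ofReal_add, add_mul, Complex.exp_add]; simp
  simp only [arcKernel, ofReal_one, one_mul, exp_mul_conj_exp]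
  rw [e, sub_self, arg_one_sub_exp (φ := a - b + 2 * Real.pi) (by linarith) (by linarith)]
  simp
  ring

lemma exists_angle {w : ℂ} (hw : ‖w‖ = 1) (b : ℝ) :
    ∃ s ∈ Ioc (b - 2 * Real.pi) b, w = exp (s * I) := by
  refine ⟨toIocMod Real.two_pi_pos (b - 2 * Real.pi) (arg w), ?_, ?_⟩
  · simpa using toIocMod_mem_Ioc Real.two_pi_pos (b - 2 * Real.pi) (arg w)
  · rw [toIocMod]
    have h1 : w = exp (arg w * I) := by
      conv_lhs => rw [← Complex.norm_mul_exp_arg_mul_I w, hw]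
      simp
    conv_lhs => rw [h1]
    rw [Complex.exp_eq_exp_iff_exists_int]
    refine ⟨toIocDiv Real.two_pi_pos (b - 2 * Real.pi) (arg w), ?_⟩
    simp
    ring

lemma injOn_exp_mul_I (c : ℝ) :
    InjOn (fun t : ℝ => exp (t * I)) (Ioc c (c + 2 * Real.pi)) := by
  have hπ := Real.pi_pos
  intro s hs t ht h
  obtain ⟨n, hn⟩ := Complex.exp_eq_exp_iff_exists_int.1 h
  have h2 : s = t + n * (2 * Real.pi) := by
    have : (s : ℂ) * I = ((t + n * (2 * Real.pi) : ℝ) : ℂ) * I := by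
      rw [hn]; push_cast; ring
    exact_mod_cast mul_right_cancel₀ I_ne_zero this
  have h3 : (n : ℝ) < 1 := by
    by_contra! hc
    nlinarith [hs.2, ht.1]
  have h4 : (-1 : ℝ) < n := by
    by_contra! hc
    nlinarith [hs.1, ht.2]
  have : n = 0 := by
    have h5 : n < 1 := by exact_mod_cast h3
    have h6 : -1 < n := by exact_mod_cast h4
    omega
  simpa [this] using h2

/-- The arc of the unit circle with angles in `s`. -/
def arc (s : Set ℝ) : Set ℂ := (fun t : ℝ => exp (t * I)) '' s

/-- The half weights at the endpoints prevent equality with an indicator. A sandwich between the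
open and the closed arc is enough, since atoms are excluded later. -/
lemma arcKernel_one_bounds {a b : ℝ} (hab : a < b) (hb : b < a + 2 * Real.pi) {w : ℂ}
    (hw : ‖w‖ = 1) :
    (arc (Ioo a b)).indicator (fun _ => 2 * Real.pi) w ≤ arcKernel a b 1 w ∧
      arcKernel a b 1 w ≤ (arc (Icc a b)).indicator (fun _ => 2 * Real.pi) w := by
  have hπ := Real.pi_pos
  have hind : ∀ S : Set ℂ, S.indicator (fun _ => 2 * Real.pi) w ≤ 2 * Real.pi ∧
      0 ≤ S.indicator (fun _ => 2 * Real.pi) w := fun S => by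
    by_cases h : w ∈ S <;> simp [h, hπ.le]
  have hinj := injOn_exp_mul_I (b - 2 * Real.pi)
  rw [sub_add_cancel] at hinj
  obtain ⟨s, hs, rfl⟩ := exists_angle hw b
  have hmem : ∀ S ⊆ Ioc (b - 2 * Real.pi) b, exp (s * I) ∈ arc S → s ∈ S := by
    rintro S hS ⟨t, ht, h⟩
    rwa [hinj hs (hS ht) h.symm]
  rcases lt_trichotomy s a with h | rfl | h
  · rw [arcKernel_one_of_mem_Ioo' hab.le ⟨hs.1, h⟩, indicator_of_notMem]
    · exact ⟨le_rfl, (hind _).2⟩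
    · intro h1
      exact absurd (hmem _ (fun x hx => ⟨by linarith [hx.1], hx.2.le⟩) h1).1 (by linarith)
  · rw [arcKernel_one_left hab hb, indicator_of_notMem, indicator_of_mem]
    · exact ⟨hπ.le, by linarith⟩
    · exact ⟨s, ⟨le_rfl, hab.le⟩, rfl⟩
    · intro h1
      exact absurd (hmem _ (fun x hx => ⟨by linarith [hx.1], hx.2.le⟩) h1).1 (by linarith)
  · have hsI : exp (s * I) ∈ arc (Icc a b) := ⟨s, ⟨h.le, hs.2⟩, rfl⟩
    rw [indicator_of_mem hsI]
    rcases hs.2.lt_or_eq with h2 | rfl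
    · rw [arcKernel_one_of_mem_Ioo hb ⟨h, h2⟩]
      exact ⟨(hind _).1, le_rfl⟩
    · rw [arcKernel_one_right hab hb, indicator_of_notMem]
      · exact ⟨hπ.le, by linarith⟩
      · intro h1
        exact absurd (hmem _ (fun x hx => ⟨by linarith [hx.1], hx.2.le⟩) h1).2 (by linarith)

lemma tendsto_arcKernel {w : ℂ} (hw : ‖w‖ = 1) (a b : ℝ) :
    Tendsto (fun r => arcKernel a b r w) (𝓝[<] 1) (𝓝 (arcKernel a b 1 w)) := by
  have key : ∀ t : ℝ, Tendsto (fun r : ℝ => arg (1 - r * exp (t * I) * conj w)) (𝓝[<] 1)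
      (𝓝 (arg (1 - (1 : ℝ) * exp (t * I) * conj w))) := by
    intro t
    by_cases h : exp (t * I) * conj w = 1
    · simp only [mul_assoc, h]
      refine tendsto_const_nhds.congr' ?_
      filter_upwards [self_mem_nhdsWithin] with r hr
      have : (1 : ℂ) - r * 1 = ((1 - r : ℝ) : ℂ) := by push_cast; ring
      rw [this, arg_ofReal_of_nonneg (by linarith [mem_Iio.1 hr])]
      simp
    · have hsl : 1 - (1 : ℝ) * exp (t * I) * conj w ∈ slitPlane := by
        refine Or.inl ?_
        rw [ofReal_one, one_mul, sub_re, one_re]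
        have h1 := norm_exp_conj hw t
        refine sub_pos.2 (lt_of_le_of_ne ((re_le_norm _).trans_eq h1) fun h2 => h ?_)
        have h3 := Complex.sq_norm (exp (t * I) * conj w)
        rw [Complex.normSq_apply, h1, h2] at h3
        have h4 : (exp (t * I) * conj w).im = 0 := by nlinarith
        exact Complex.ext h2 h4
      refine Tendsto.mono_left ?_ nhdsWithin_le_nhds
      have hc : Continuous fun r : ℝ => 1 - (r : ℂ) * exp (t * I) * conj w := by fun_prop
      exact (continuousAt_arg hsl).tendsto.comp hc.continuousAt.tendsto
  exact (((key b).const_mul 2).const_sub (b - a)).add ((key a).const_mul 2)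

lemma abs_arcKernel_le (a b r : ℝ) (w : ℂ) : |arcKernel a b r w| ≤ |b - a| + 4 * Real.pi := by
  have h1 := abs_arg_le_pi (1 - r * exp (b * I) * conj w)
  have h2 := abs_arg_le_pi (1 - r * exp (a * I) * conj w)
  have h3 := le_abs_self (b - a)
  have h4 := neg_abs_le (b - a)
  rw [abs_le] at h1 h2 ⊢
  unfold arcKernel
  constructor <;> linarith

end CMV
end

/-! ### Poisson integrals of measures and densities from boundary values -/

noncomputable section
namespace CMV

/-- The Poisson integral of a measure on the circle. -/
def poissonIntegral (ν : Measure ℂ) (z : ℂ) : ℝ := ∫ w, ((w + z) / (w - z)).re ∂ν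

variable {ν : Measure ℂ} [IsFiniteMeasure ν]

lemma norm_re_div_le {w z : ℂ} (hw : ‖w‖ = 1) {R : ℝ} (hz : ‖z‖ ≤ R) (hR : R < 1) :
    ‖((w + z) / (w - z)).re‖ ≤ 2 / (1 - R) := by
  refine (Complex.abs_re_le_norm _).trans ?_
  rw [norm_div]
  have h5 : 1 - R ≤ ‖w - z‖ := by
    have := norm_sub_norm_le w z
    rw [hw] at this
    linarith
  have h6 : ‖w + z‖ ≤ 2 := by
    have := norm_add_le w z
    rw [hw] at this
    linarith
  have : 0 < 1 - R := by linarith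
  gcongr

lemma continuousOn_poissonIntegral (hae : ∀ᵐ w ∂ν, ‖w‖ = 1) :
    ContinuousOn (poissonIntegral ν) (Metric.ball 0 1) := by
  intro z₀ hz₀
  rw [mem_ball_zero_iff] at hz₀
  refine ContinuousAt.continuousWithinAt ?_
  have hnear : ∀ᶠ z : ℂ in 𝓝 z₀, ‖z‖ ≤ (‖z₀‖ + 1) / 2 :=
    (continuous_norm.continuousAt.eventually_lt continuousAt_const (by linarith)).mono
      fun z hz => le_of_lt hz
  refine continuousAt_of_dominated (bound := fun _ => 2 / (1 - (‖z₀‖ + 1) / 2))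
    (Eventually.of_forall fun z => Measurable.aestronglyMeasurable (by fun_prop)) ?_
    (integrable_const _) ?_
  · filter_upwards [hnear] with z hz
    filter_upwards [hae] with w hw
    exact norm_re_div_le hw hz (by linarith)
  · filter_upwards [hae] with w hw
    refine Complex.continuous_re.continuousAt.comp
      ((continuousAt_const.add continuousAt_id).div (continuousAt_const.sub continuousAt_id) ?_)
    intro h0
    rw [sub_eq_zero] at h0
    rw [h0] at hw
    exact absurd hw hz₀.ne

lemma integral_poissonIntegral_arc (hae : ∀ᵐ w ∂ν, ‖w‖ = 1) {a b r : ℝ} (hab : a ≤ b)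
    (hr : |r| < 1) :
    ∫ t in a..b, poissonIntegral ν (r * exp (t * I)) = ∫ w, arcKernel a b r w ∂ν := by
  rw [intervalIntegral.integral_of_le hab]
  simp only [poissonIntegral]
  have hint : Integrable (fun p : ℝ × ℂ =>
      ((p.2 + r * exp (p.1 * I)) / (p.2 - r * exp (p.1 * I))).re)
      ((volume.restrict (Ioc a b)).prod ν) := by
    refine Integrable.of_bound (C := 2 / (1 - |r|))
      (Measurable.aestronglyMeasurable (by fun_prop)) ?_
    have := (Measure.quasiMeasurePreserving_snd (μ := volume.restrict (Ioc a b)) (ν := ν)).ae hae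
    filter_upwards [this] with p hp
    refine norm_re_div_le hp ?_ hr
    rw [norm_mul, norm_exp_ofReal_mul_I]
    simp
  rw [integral_integral_swap hint]
  refine integral_congr_ae ?_
  filter_upwards [hae] with w hw
  rw [← integral_poisson_arc hw hr a b, intervalIntegral.integral_of_le hab]

lemma measurable_arcKernel (a b r : ℝ) : Measurable (arcKernel a b r) := by
  unfold arcKernel
  exact ((measurable_const.sub ((Complex.measurable_arg.comp (by fun_prop)).const_mul 2))).add
    ((Complex.measurable_arg.comp (by fun_prop)).const_mul 2)

lemma tendsto_integral_arcKernel (hae : ∀ᵐ w ∂ν, ‖w‖ = 1) (a b : ℝ) :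
    Tendsto (fun r => ∫ w, arcKernel a b r w ∂ν) (𝓝[<] 1) (𝓝 (∫ w, arcKernel a b 1 w ∂ν)) := by
  refine tendsto_integral_filter_of_dominated_convergence (fun _ => |b - a| + 4 * Real.pi)
    (Eventually.of_forall fun r => (measurable_arcKernel a b r).aestronglyMeasurable)
    (Eventually.of_forall fun r => Eventually.of_forall fun w => abs_arcKernel_le a b r w)
    (integrable_const _) ?_
  filter_upwards [hae] with w hw
  exact tendsto_arcKernel hw a b

/-- The polar coordinate `r e^{it}`. -/
lemma tendsto_polar (t : ℝ) :
    Tendsto (fun r : ℝ => (r : ℂ) * exp (t * I)) (𝓝[<] 1)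
      (𝓝[Metric.ball (0 : ℂ) 1] (exp (t * I))) := by
  refine tendsto_nhdsWithin_iff.2 ⟨?_, ?_⟩
  · have : Continuous fun r : ℝ => (r : ℂ) * exp (t * I) := by fun_prop
    simpa using this.continuousAt.tendsto.mono_left (nhdsWithin_le_nhds (a := (1 : ℝ)) (s := Iio 1))
  · filter_upwards [Ioo_mem_nhdsLT (show (0 : ℝ) < 1 by norm_num)] with r hr
    rw [mem_ball_zero_iff, norm_mul, norm_exp_ofReal_mul_I, mul_one, Complex.norm_real,
      Real.norm_of_nonneg hr.1.le]
    exact hr.2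

lemma exp_mem_closure_ball (t : ℝ) : exp (t * I) ∈ closure (Metric.ball (0 : ℂ) 1) := by
  rw [closure_ball _ one_ne_zero]
  simp

variable {g : ℝ → ℝ} {I₀ : Set ℝ}

/-- The extension of the Poisson integral to the boundary arcs where it has boundary values. -/
lemma continuousOn_extendFrom_poissonIntegral (hae : ∀ᵐ w ∂ν, ‖w‖ = 1)
    (hg : ∀ t ∈ I₀, Tendsto (poissonIntegral ν) (𝓝[Metric.ball (0 : ℂ) 1] (exp (t * I)))
      (𝓝 (g t))) :
    ContinuousOn (extendFrom (Metric.ball 0 1) (poissonIntegral ν))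
      (Metric.ball 0 1 ∪ arc I₀) := by
  refine continuousOn_extendFrom ?_ ?_
  · rintro z (hz | ⟨t, -, rfl⟩)
    · exact subset_closure hz
    · exact exp_mem_closure_ball t
  · rintro z (hz | ⟨t, ht, rfl⟩)
    · exact ⟨_, continuousOn_poissonIntegral hae z hz⟩
    · exact ⟨_, hg t ht⟩

lemma continuousOn_boundary (hae : ∀ᵐ w ∂ν, ‖w‖ = 1)
    (hg : ∀ t ∈ I₀, Tendsto (poissonIntegral ν) (𝓝[Metric.ball (0 : ℂ) 1] (exp (t * I)))
      (𝓝 (g t))) : ContinuousOn g I₀ := by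
  have h := (continuousOn_extendFrom_poissonIntegral hae hg).comp (s := I₀)
    (f := fun t : ℝ => exp (t * I)) (by fun_prop) (fun t ht => Or.inr ⟨t, ht, rfl⟩)
  refine h.congr fun t ht => ?_
  exact (extendFrom_eq (exp_mem_closure_ball t) (hg t ht)).symm

/-- The integral of the Poisson integral over an arc of radius `r` is computed in two ways as `r →
1`: by Fubini it is the integral of `arcKernel`, and by dominated convergence it tends to the
integral of the boundary values. -/
lemma integral_arcKernel_one (hae : ∀ᵐ w ∂ν, ‖w‖ = 1)
    (hg : ∀ t ∈ I₀, Tendsto (poissonIntegral ν) (𝓝[Metric.ball (0 : ℂ) 1] (exp (t * I)))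
      (𝓝 (g t))) {a b : ℝ} (hab : a ≤ b) (hI : Icc a b ⊆ I₀) :
    ∫ w, arcKernel a b 1 w ∂ν = ∫ t in a..b, g t := by
  refine tendsto_nhds_unique (tendsto_integral_arcKernel hae a b) ?_
  set G := extendFrom (Metric.ball (0 : ℂ) 1) (poissonIntegral ν) with hG
  have hGc := continuousOn_extendFrom_poissonIntegral hae hg
  have hGin : ∀ z ∈ Metric.ball (0 : ℂ) 1, G z = poissonIntegral ν z := fun z hz =>
    extendFrom_eq (subset_closure hz) (continuousOn_poissonIntegral hae z hz)
  have hpc : Continuous fun p : ℝ × ℝ => (p.1 : ℂ) * exp (p.2 * I) := by fun_prop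
  have hpm : MapsTo (fun p : ℝ × ℝ => (p.1 : ℂ) * exp (p.2 * I)) (Icc 0 1 ×ˢ Icc a b)
      (Metric.ball 0 1 ∪ arc I₀) := by
    rintro ⟨r, t⟩ ⟨hr, ht⟩
    rcases hr.2.lt_or_eq with h | h
    · left
      simp only [mem_ball_zero_iff, norm_mul, norm_exp_ofReal_mul_I, mul_one, Complex.norm_real,
        Real.norm_of_nonneg hr.1]
      exact h
    · right
      exact ⟨t, hI ht, by simp_all⟩
  have hc2 : ContinuousOn (fun p : ℝ × ℝ => G (p.1 * exp (p.2 * I))) (Icc 0 1 ×ˢ Icc a b) :=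
    hGc.comp hpc.continuousOn hpm
  -- The extension is continuous up to the boundary on a compact sector; its bound there is the
  -- dominating constant.
  obtain ⟨M, hM⟩ := (isCompact_Icc.prod isCompact_Icc).exists_bound_of_continuousOn hc2
  have hev : ∀ᶠ r : ℝ in 𝓝[<] 1, r ∈ Ioo (0 : ℝ) 1 := Ioo_mem_nhdsLT (by norm_num)
  have hball : ∀ r ∈ Ioo (0 : ℝ) 1, ∀ t : ℝ, (r : ℂ) * exp (t * I) ∈ Metric.ball (0 : ℂ) 1 := by
    intro r hr t
    simp only [mem_ball_zero_iff, norm_mul, norm_exp_ofReal_mul_I, mul_one, Complex.norm_real,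
      Real.norm_of_nonneg hr.1.le]
    exact hr.2
  have key : Tendsto (fun r : ℝ => ∫ t in a..b, poissonIntegral ν (r * exp (t * I))) (𝓝[<] 1)
      (𝓝 (∫ t in a..b, g t)) := by
    refine intervalIntegral.tendsto_integral_filter_of_dominated_convergence (fun _ => M) ?_ ?_
      intervalIntegrable_const ?_
    · filter_upwards [hev] with r hr
      refine Continuous.aestronglyMeasurable ?_
      exact (continuousOn_poissonIntegral hae).comp_continuous (by fun_prop) (hball r hr)
    · filter_upwards [hev] with r hr
      refine Eventually.of_forall fun t ht => ?_
      rw [uIoc_of_le hab] at ht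
      rw [← hGin _ (hball r hr t)]
      exact hM (r, t) ⟨⟨hr.1.le, hr.2.le⟩, ht.1.le, ht.2⟩
    · refine Eventually.of_forall fun t ht => ?_
      rw [uIoc_of_le hab] at ht
      exact (hg t (hI ⟨ht.1.le, ht.2⟩)).comp (tendsto_polar t)
  refine key.congr' ?_
  filter_upwards [hev] with r hr
  exact integral_poissonIntegral_arc hae hab (by rw [abs_of_pos hr.1]; exact hr.2)

lemma measurableSet_arc {c : ℝ} {s : Set ℝ} (hs : MeasurableSet s)
    (hc : s ⊆ Ioc c (c + 2 * Real.pi)) : MeasurableSet (arc s) :=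
  hs.image_of_continuousOn_injOn (by fun_prop) ((injOn_exp_mul_I c).mono hc)

lemma angularCDF_eq_add {τ a b : ℝ} (ha : τ - Real.pi ≤ a) (hab : a ≤ b)
    (hb : b ≤ τ + Real.pi) :
    angularCDF ν τ b = angularCDF ν τ a + ν.real (arc (Ioc a b)) := by
  have hsub : ∀ {x y}, τ - Real.pi ≤ x → y ≤ τ + Real.pi →
      Ioc x y ⊆ Ioc (τ - Real.pi) (τ - Real.pi + 2 * Real.pi) := fun hx hy u hu =>
    ⟨hx.trans_lt hu.1, by linarith [hu.2]⟩
  change ν.real (arc _) = ν.real (arc _) + _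
  rw [← measureReal_union _ (measurableSet_arc measurableSet_Ioc (hsub ha hb)), arc, arc, arc,
    ← image_union, Ioc_union_Ioc_eq_Ioc ha hab]
  refine disjoint_image_image fun s hs t ht h => ?_
  have := injOn_exp_mul_I (τ - Real.pi) (hsub le_rfl (by linarith) hs) (hsub ha hb ht) h
  exact absurd ht.1 (by linarith [hs.2])

/-- Where the Poisson integral of a measure on the circle has boundary values, the measure has
the corresponding density. -/
lemma hasDerivAt_angularCDF (hae : ∀ᵐ w ∂ν, ‖w‖ = 1) {τ ε : ℝ} (hε : 0 < ε) (hε1 : ε ≤ 1)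
    (hg : ∀ t ∈ Ioo (τ - ε) (τ + ε),
      Tendsto (poissonIntegral ν) (𝓝[Metric.ball (0 : ℂ) 1] (exp (t * I))) (𝓝 (g t))) :
    HasDerivAt (angularCDF ν τ) ((2 * Real.pi)⁻¹ * g τ) τ := by
  have hπ := Real.pi_gt_three
  have hτ : τ ∈ Ioo (τ - ε) (τ + ε) := ⟨by linarith, by linarith⟩
  have hgc := continuousOn_boundary hae hg
  have hint : ∀ a ∈ Ioo (τ - ε) (τ + ε), ∀ b ∈ Ioo (τ - ε) (τ + ε),
      IntervalIntegrable g volume a b := fun a ha b hb =>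
    (hgc.mono (ordConnected_Ioo.uIcc_subset ha hb)).intervalIntegrable
  set F : ℝ → ℝ := fun u => ∫ t in τ..u, g t with hF
  have hFd : ∀ u ∈ Ioo (τ - ε) (τ + ε), HasDerivAt F (g u) u := fun u hu =>
    intervalIntegral.integral_hasDerivAt_right (hint τ hτ u hu)
      (hgc.stronglyMeasurableAtFilter isOpen_Ioo u hu) (hgc.continuousAt (isOpen_Ioo.mem_nhds hu))
  have hsubF : ∀ a ∈ Ioo (τ - ε) (τ + ε), ∀ b ∈ Ioo (τ - ε) (τ + ε),
      ∫ t in a..b, g t = F b - F a := fun a ha b hb =>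
    (intervalIntegral.integral_interval_sub_left (hint τ hτ b hb) (hint τ hτ a ha)).symm
  have hIcc : ∀ {a b}, a ∈ Ioo (τ - ε) (τ + ε) → b ∈ Ioo (τ - ε) (τ + ε) →
      Icc a b ⊆ Ioc (τ - Real.pi) (τ - Real.pi + 2 * Real.pi) := fun ha hb u hu =>
    ⟨by linarith [ha.1, hu.1], by linarith [hb.2, hu.2]⟩
  have hK : ∀ a b r, Integrable (fun w => arcKernel a b r w) ν := fun a b r =>
    Integrable.of_bound (measurable_arcKernel a b r).aestronglyMeasurable (|b - a| + 4 * Real.pi)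
      (Eventually.of_forall fun w => abs_arcKernel_le a b r w)
  have hind : ∀ {S : Set ℂ}, MeasurableSet S →
      ∫ w, S.indicator (fun _ => 2 * Real.pi) w ∂ν = 2 * Real.pi * ν.real S := fun hS => by
    rw [integral_indicator_const _ hS, smul_eq_mul, mul_comm]
  have hbounds : ∀ a ∈ Ioo (τ - ε) (τ + ε), ∀ b ∈ Ioo (τ - ε) (τ + ε), a < b →
      2 * Real.pi * ν.real (arc (Ioo a b)) ≤ F b - F a ∧
        F b - F a ≤ 2 * Real.pi * ν.real (arc (Icc a b)) := by
    intro a ha b hb hab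
    have m1 : MeasurableSet (arc (Icc a b)) := measurableSet_arc measurableSet_Icc (hIcc ha hb)
    have m2 : MeasurableSet (arc (Ioo a b)) :=
      measurableSet_arc measurableSet_Ioo (Ioo_subset_Icc_self.trans (hIcc ha hb))
    rw [← hsubF a ha b hb, ← integral_arcKernel_one hae hg hab.le
      (ordConnected_Ioo.out ha hb), ← hind m1, ← hind m2]
    have hb' : b < a + 2 * Real.pi := by linarith [ha.1, hb.2]
    constructor
    · refine integral_mono_ae ((integrable_const _).indicator m2) (hK a b 1) ?_
      filter_upwards [hae] with w hw using (arcKernel_one_bounds hab hb' hw).1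
    · refine integral_mono_ae (hK a b 1) ((integrable_const _).indicator m1) ?_
      filter_upwards [hae] with w hw using (arcKernel_one_bounds hab hb' hw).2
  -- Apply the lower bound to slightly larger open arcs and use continuity of `F`. The case `a = b`
  -- is allowed and shows that there are no atoms.
  have hupper : ∀ a ∈ Ioo (τ - ε) (τ + ε), ∀ b ∈ Ioo (τ - ε) (τ + ε), a ≤ b →
      2 * Real.pi * ν.real (arc (Icc a b)) ≤ F b - F a := by
    intro a ha b hb hab
    have h1 : Tendsto (fun δ : ℝ => F (b + δ) - F (a - δ)) (𝓝[>] 0) (𝓝 (F b - F a)) := by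
      have c1 : ContinuousAt (fun δ : ℝ => F (b + δ)) 0 :=
        ContinuousAt.comp (g := F) (by simpa using (hFd b hb).continuousAt) (by fun_prop)
      have c2 : ContinuousAt (fun δ : ℝ => F (a - δ)) 0 :=
        ContinuousAt.comp (g := F) (by simpa using (hFd a ha).continuousAt) (by fun_prop)
      have c3 : ContinuousAt (fun δ : ℝ => F (b + δ) - F (a - δ)) 0 := c1.sub c2
      simpa using c3.tendsto.mono_left (nhdsWithin_le_nhds (s := Ioi (0 : ℝ)))
    refine ge_of_tendsto h1 ?_
    have h2 : 0 < min (τ + ε - b) (a - (τ - ε)) :=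
      lt_min (by linarith [hb.2]) (by linarith [ha.1])
    filter_upwards [Ioo_mem_nhdsGT h2] with δ hδ
    have h3 := hδ.2.trans_le (min_le_left _ _)
    have h4 := hδ.2.trans_le (min_le_right _ _)
    have h5 := hδ.1
    refine le_trans ?_ (hbounds (a - δ) ⟨by linarith, by linarith [hb.2]⟩ (b + δ)
      ⟨by linarith [ha.1], by linarith⟩ (by linarith)).1
    refine mul_le_mul_of_nonneg_left (measureReal_mono (image_mono fun u hu => ?_)) (by positivity)
    exact ⟨by linarith [hu.1], by linarith [hu.2]⟩
  have hIoc : ∀ a ∈ Ioo (τ - ε) (τ + ε), ∀ b ∈ Ioo (τ - ε) (τ + ε), a ≤ b →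
      ν.real (arc (Ioc a b)) = (2 * Real.pi)⁻¹ * (F b - F a) := by
    intro a ha b hb hab
    rcases hab.eq_or_lt with rfl | hlt
    · simp [arc]
    have h0 : ν.real (arc (Icc a a)) = 0 := by
      have := hupper a ha a ha le_rfl
      rw [sub_self] at this
      have h6 : 0 ≤ ν.real (arc (Icc a a)) := measureReal_nonneg
      nlinarith
    have h1 : ν.real (arc (Icc a b)) ≤ ν.real (arc (Ioc a b)) := by
      have : arc (Icc a b) = arc (Icc a a) ∪ arc (Ioc a b) := by
        rw [arc, arc, arc, ← image_union, Icc_self, singleton_union, Ioc_insert_left hab]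
      rw [this]
      exact (measureReal_union_le _ _).trans (by rw [h0, zero_add])
    have h2 : ν.real (arc (Ioc a b)) ≤ ν.real (arc (Icc a b)) :=
      measureReal_mono (image_mono Ioc_subset_Icc_self)
    have h3 := (hbounds a ha b hb hlt).2
    have h4 := hupper a ha b hb hab
    field_simp
    nlinarith
  have hCDF : ∀ t ∈ Ioo (τ - ε) (τ + ε),
      angularCDF ν τ t = angularCDF ν τ τ + (2 * Real.pi)⁻¹ * F t := by
    intro t ht
    have hF0 : F τ = 0 := intervalIntegral.integral_same
    rcases le_total τ t with h | h
    · rw [angularCDF_eq_add (by linarith) h (by linarith [ht.2]), hIoc τ hτ t ht h, hF0, sub_zero]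
    · have := angularCDF_eq_add (ν := ν) (τ := τ) (a := t) (b := τ) (by linarith [ht.1]) h
        (by linarith)
      rw [this, hIoc t ht τ hτ h, hF0]
      ring
  refine (((hFd τ hτ).const_mul (2 * Real.pi)⁻¹).const_add (angularCDF ν τ τ)).congr_of_eventuallyEq ?_
  filter_upwards [isOpen_Ioo.mem_nhds hτ] with t ht using hCDF t ht

end CMV
end

noncomputable section
namespace CMV

open scoped Matrix

/-! ### Transfer matrices -/

lemma rho_ne_zero (a : UnitDisc) : (rho a : ℂ) ≠ 0 := by
  have h := rho_sq a
  have h1 := a.sq_norm_lt_one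
  intro h0
  have : rho a = 0 := by exact_mod_cast h0
  rw [this] at h
  nlinarith

lemma rho_sq_complex (a : UnitDisc) : (rho a : ℂ) ^ 2 = 1 - (a : ℂ) * conj (a : ℂ) := by
  rw [Complex.mul_conj']; exact_mod_cast rho_sq a

variable (α : ℕ → UnitDisc) (lam : ℕ → Circle) {z : ℂ}

lemma det_transferY (hz : z ≠ 0) (n : ℕ) : (transferY α lam z n).det = -1 := by
  have h1 := rho_ne_zero (α n)
  have h2 := rho_sq_complex (α n)
  have h3 : (lam n : ℂ) ≠ 0 := Circle.coe_ne_zero _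
  unfold transferY
  split_ifs
  · simp only [transferQ, Matrix.det_fin_two, Matrix.smul_apply, smul_eq_mul, Matrix.of_apply,
      Matrix.cons_val', Matrix.cons_val_zero, Matrix.cons_val_one, Matrix.cons_val_fin_one]
    field_simp
    linear_combination h2
  · simp only [transferP, Matrix.det_fin_two, Matrix.smul_apply, smul_eq_mul, Matrix.of_apply,
      Matrix.cons_val', Matrix.cons_val_zero, Matrix.cons_val_one, Matrix.cons_val_fin_one]
    field_simp
    linear_combination h2

lemma det_transferZ (hz : z ≠ 0) (n : ℕ) : (transferZ α lam z n).det = (-1) ^ n := by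
  induction n with
  | zero => simp [transferZ]
  | succ n ih => rw [transferZ, Matrix.det_mul, det_transferY α lam hz, ih, pow_succ']

/-- Only an even shift preserves the alternation of `Q` and `P`. -/
lemma transferZ_add_even (z : ℂ) (n : ℕ) {p : ℕ} (hp : Even p) :
    transferZ α lam z (n + p) =
      transferZ (fun n => α (n + p)) (fun n => lam (n + p)) z n * transferZ α lam z p := by
  induction n with
  | zero => simp [transferZ]
  | succ n ih =>
    rw [Nat.add_right_comm, transferZ, transferZ, ih, Matrix.mul_assoc]
    congr 1
    simp [transferY, Nat.even_add, hp]

lemma transferZ_add_mul {q : ℕ} (hq : Even q) (hα : ∀ n, α (n + q) = α n)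
    (hlam : ∀ n, lam (n + q) = lam n) (z : ℂ) (r m : ℕ) :
    transferZ α lam z (r + q * m) = transferZ α lam z r * transferZ α lam z q ^ m := by
  induction m generalizing r with
  | zero => simp
  | succ m ih =>
    rw [Nat.mul_succ, ← Nat.add_assoc, transferZ_add_even α lam z _ hq]
    simp only [hα, hlam]
    rw [ih, pow_succ, Matrix.mul_assoc]

/-- The solution of the transfer matrix recursion with initial value `v` decays. -/
def Decays (z : ℂ) (v : Fin 2 → ℂ) : Prop :=
  Tendsto (fun k => transferZ α lam z k *ᵥ v) atTop (𝓝 0)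

variable {α lam}

lemma Decays.smul {v : Fin 2 → ℂ} (h : Decays α lam z v) (c : ℂ) : Decays α lam z (c • v) := by
  have := Tendsto.const_smul h c
  simpa [Decays, Matrix.mulVec_smul] using this

lemma Decays.shift {v : Fin 2 → ℂ} (h : Decays α lam z v) {p : ℕ} (hp : Even p) :
    Decays (fun n => α (n + p)) (fun n => lam (n + p)) z (transferZ α lam z p *ᵥ v) := by
  have := h.comp (tendsto_add_atTop_nat p)
  refine this.congr fun k => ?_
  rw [Function.comp_apply, transferZ_add_even α lam z k hp, Matrix.mulVec_mulVec]

lemma mulVec_wedge (A : Matrix (Fin 2) (Fin 2) ℂ) (v w : Fin 2 → ℂ) :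
    (A *ᵥ v) 0 * (A *ᵥ w) 1 - (A *ᵥ v) 1 * (A *ᵥ w) 0 = A.det * (v 0 * w 1 - v 1 * w 0) := by
  simp only [Matrix.mulVec, dotProduct, Fin.sum_univ_two, Matrix.det_fin_two]
  ring

/-- Decaying initial values are unique up to multiples. -/
lemma Decays.wedge_eq_zero (hz : z ≠ 0) {v w : Fin 2 → ℂ} (hv : Decays α lam z v)
    (hw : Decays α lam z w) : v 0 * w 1 - v 1 * w 0 = 0 := by
  have hv' := fun i => (tendsto_pi_nhds.1 hv) i
  have hw' := fun i => (tendsto_pi_nhds.1 hw) i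
  -- The wedge of two solutions has constant modulus since the transfer matrices have determinant
  -- `-1`, and it tends to `0` if both decay.
  have h := (((hv' 0).mul (hw' 1)).sub ((hv' 1).mul (hw' 0))).norm
  simp only [mulVec_wedge, det_transferZ α lam hz, norm_mul, norm_pow, norm_neg, norm_one, one_pow,
    one_mul, Pi.zero_apply, mul_zero, sub_zero, norm_zero] at h
  exact norm_eq_zero.1 (tendsto_nhds_unique tendsto_const_nhds h)

/-! ### The resolvent -/

variable (α lam)

lemma cmv_mul_star_cmv : (cmv α lam : Ell2 →L[ℂ] Ell2) * star (cmv α lam : Ell2 →L[ℂ] Ell2) = 1 :=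
  Unitary.coe_mul_star_self _

/-- The vector `(𝒞 - z)⁻¹ δ_n`. -/
def resolventVec (z : ℂ) (n : ℕ) : Ell2 :=
  ∑' k : ℕ, z ^ k • (star (cmv α lam : Ell2 →L[ℂ] Ell2) ^ (k + 1)) (delta n)

lemma norm_star_cmv_pow (k n : ℕ) :
    ‖(star (cmv α lam : Ell2 →L[ℂ] Ell2) ^ k) (delta n)‖ ≤ 1 := by
  have hu : star (cmv α lam : Ell2 →L[ℂ] Ell2) ^ k ∈ unitary (Ell2 →L[ℂ] Ell2) :=
    pow_mem (Unitary.star_mem (cmv α lam).2) k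
  rw [ContinuousLinearMap.norm_map_of_mem_unitary hu, norm_delta]

lemma summable_resolventVec (hz : ‖z‖ < 1) (n i : ℕ) : Summable fun k : ℕ =>
    z ^ k • (star (cmv α lam : Ell2 →L[ℂ] Ell2) ^ (k + i)) (delta n) := by
  refine Summable.of_norm_bounded (summable_geometric_of_lt_one (norm_nonneg z) hz) fun k => ?_
  rw [norm_smul, norm_pow]
  exact mul_le_of_le_one_right (by positivity) (norm_star_cmv_pow α lam _ n)

/-- The series is the Neumann series with `𝒞⁻¹ = 𝒞*`; applying `𝒞` lowers each power by one. -/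
lemma cmv_resolventVec (hz : ‖z‖ < 1) (n : ℕ) :
    (cmv α lam : Ell2 →L[ℂ] Ell2) (resolventVec α lam z n)
      = z • resolventVec α lam z n + delta n := by
  rw [resolventVec, ContinuousLinearMap.map_tsum _ (summable_resolventVec α lam hz n 1)]
  have e : ∀ k : ℕ, (cmv α lam : Ell2 →L[ℂ] Ell2)
      (z ^ k • (star (cmv α lam : Ell2 →L[ℂ] Ell2) ^ (k + 1)) (delta n))
      = z ^ k • (star (cmv α lam : Ell2 →L[ℂ] Ell2) ^ (k + 0)) (delta n) := by
    intro k
    rw [map_smul, pow_succ', ← mul_apply_eq_comp, ← mul_assoc, cmv_mul_star_cmv, one_mul,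
      add_zero]
  simp only [e]
  rw [(summable_resolventVec α lam hz n 0).tsum_eq_zero_add,
    ← (summable_resolventVec α lam hz n 1).tsum_const_smul, add_comm]
  congr 1
  · refine tsum_congr fun k => ?_
    rw [smul_smul, pow_succ', add_zero]
  · simp

lemma inner_star_cmv_pow (k n : ℕ) :
    ⟪delta n, (star (cmv α lam : Ell2 →L[ℂ] Ell2) ^ k) (delta n)⟫_ℂ = conj (diagPow α lam k n) := by
  rw [← star_pow, ContinuousLinearMap.star_eq_adjoint, ContinuousLinearMap.adjoint_inner_right,
    ← inner_conj_symm, inner_cmv_pow]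

lemma hasSum_resolventVec (hz : ‖z‖ < 1) (n : ℕ) :
    HasSum (fun k : ℕ => z ^ k * conj (diagPow α lam (k + 1) n)) (resolventVec α lam z n n) := by
  have h := (summable_resolventVec α lam hz n 1).hasSum
  have h2 := h.mapL (innerSL ℂ (delta n))
  simp only [innerSL_apply_apply, inner_smul_right, inner_star_cmv_pow] at h2
  rw [inner_delta] at h2
  exact h2

lemma caratheodory_eq (hz : ‖z‖ < 1) :
    caratheodory α lam z = 1 + 2 * z * resolventVec α lam z 0 0 := by
  have h1 := hasSum_caratheodory α lam hz
  have h2 := (hasSum_resolventVec α lam hz 0).mul_left (2 * z)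
  have h3 : caratheodory α lam z - 1 = 2 * z * resolventVec α lam z 0 0 := by
    refine h1.unique ?_
    have e : ∀ k : ℕ, 2 * z ^ (k + 1) * conj (diagPow α lam (k + 1) 0)
        = 2 * z * (z ^ k * conj (diagPow α lam (k + 1) 0)) := fun k => by ring
    simpa only [e] using h2
  linear_combination h3

/-! ### Solutions of the transfer matrix recursion from the resolvent -/

/-- The vector entering the `k`-th transfer matrix, for the resolvent equation with solution `f`. -/
def inVec (z : ℂ) (f : ℕ → ℂ) (k : ℕ) : Fin 2 → ℂ :=
  if Even k then ![f k, seqM α lam f k] else ![seqC α lam f k / z, seqM α lam f k]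

/-- The vector to which the `k`-th transfer matrix is applied. -/
def outVec (z : ℂ) (f : ℕ → ℂ) (k : ℕ) : Fin 2 → ℂ :=
  if Even k then ![seqC α lam f k / z, seqM α lam f k] else ![f k, seqM α lam f k]

/-- `Y(k)` rewrites the `2 × 2` block of `𝓛₊` (even `k`) or `𝓜₊` (odd `k`) as a map from site `k` to
site `k + 1`. This holds for every `f`; the equation `𝒞 f = z f` enters only in identifying `inVec`
with `outVec`. -/
lemma inVec_succ (hz : z ≠ 0) (f : ℕ → ℂ) (k : ℕ) :
    inVec α lam z f (k + 1) = transferY α lam z k *ᵥ outVec α lam z f k := by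
  have h1 := rho_ne_zero (α k)
  have h2 := rho_sq_complex (α k)
  have h3 : (lam k : ℂ) ≠ 0 := Circle.coe_ne_zero _
  obtain ⟨j, rfl | rfl⟩ := Nat.even_or_odd' k
  · have e1 := seqL_even α lam (seqM α lam f) j
    have e2 := seqL_odd α lam (seqM α lam f) j
    have p1 : Even (2 * j) := even_two_mul j
    have p2 : ¬ Even (2 * j + 1) := by simp
    change seqC α lam f (2 * j) = _ at e1
    change seqC α lam f (2 * j + 1) = _ at e2
    simp only [inVec, outVec, transferY, transferQ, p1, p2, if_true, if_false, e1, e2]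
    ext i
    fin_cases i
    · simp [Matrix.mulVec, dotProduct, Fin.sum_univ_two]
      field_simp
      linear_combination (seqM α lam f (2 * j)) * h2
    · simp [Matrix.mulVec, dotProduct, Fin.sum_univ_two]
      field_simp
      ring
  · have e1 := seqM_odd α lam f j
    have e2 := seqM_even α lam f j
    have p1 : ¬ Even (2 * j + 1) := by simp
    have p2 : Even (2 * j + 1 + 1) := by
      rw [Nat.even_add_one]; exact p1
    have e3 : 2 * j + 1 + 1 = 2 * j + 2 := rfl
    simp only [inVec, outVec, transferY, transferP, p1, p2, if_true, if_false, e3, e1, e2]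
    ext i
    fin_cases i
    · simp [Matrix.mulVec, dotProduct, Fin.sum_univ_two]
      field_simp
      ring
    · simp [Matrix.mulVec, dotProduct, Fin.sum_univ_two]
      field_simp
      linear_combination (f (2 * j + 1)) * h2

end CMV
end

/-! ### Decaying solutions, the Schur function and the diagonal of the resolvent -/

noncomputable section
namespace CMV

open scoped Matrix

variable (α : ℕ → UnitDisc) (lam : ℕ → Circle) {z : ℂ}

lemma seqC_resolventVec (hz : ‖z‖ < 1) (n k : ℕ) :
    seqC α lam (resolventVec α lam z n) k
      = z * resolventVec α lam z n k + (Pi.single n 1 : ℕ → ℂ) k := by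
  have h := congrArg (fun f : Ell2 => (f : ℕ → ℂ) k) (cmv_resolventVec α lam hz n)
  exact h

lemma inVec_resolventVec_zero (z : ℂ) (n : ℕ) :
    inVec α lam z (resolventVec α lam z n) 0 = resolventVec α lam z n 0 • ![1, 1] := by
  ext i
  fin_cases i <;> simp [inVec, seqM_zero]

lemma inVec_eq_outVec (hz : ‖z‖ < 1) (hz0 : z ≠ 0) {n k : ℕ} (hk : k ≠ n) :
    inVec α lam z (resolventVec α lam z n) k = outVec α lam z (resolventVec α lam z n) k := by
  have h : seqC α lam (resolventVec α lam z n) k / z = resolventVec α lam z n k := by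
    rw [seqC_resolventVec α lam hz, Pi.single_eq_of_ne hk]
    field_simp
    ring
  simp [inVec, outVec, h]

/-- The source `δ_n` produces the jump; its sign alternates because `f` and `𝒞 f / z` exchange their
roles with the parity of the site. -/
lemma outVec_sub_inVec (hz : ‖z‖ < 1) (hz0 : z ≠ 0) (n : ℕ) :
    outVec α lam z (resolventVec α lam z n) n
      = inVec α lam z (resolventVec α lam z n) n + ![(-1) ^ n / z, 0] := by
  have h : seqC α lam (resolventVec α lam z n) n / z = resolventVec α lam z n n + 1 / z := by
    rw [seqC_resolventVec α lam hz, Pi.single_eq_same]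
    field_simp
  ext i
  by_cases hn : Even n
  · fin_cases i <;> simp [inVec, outVec, h, hn]
  · have hn' := Nat.not_even_iff_odd.1 hn
    fin_cases i <;> simp [inVec, outVec, h, hn, hn'.neg_one_pow]
    ring

lemma inVec_eq_left (hz : ‖z‖ < 1) (hz0 : z ≠ 0) (n k : ℕ) (hk : k ≤ n) :
    inVec α lam z (resolventVec α lam z n) k
      = resolventVec α lam z n 0 • (transferZ α lam z k *ᵥ ![1, 1]) := by
  induction k with
  | zero => rw [inVec_resolventVec_zero, transferZ, Matrix.one_mulVec]
  | succ k ih =>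
    rw [inVec_succ α lam hz0, ← inVec_eq_outVec α lam hz hz0 (by omega), ih (by omega),
      Matrix.mulVec_smul, Matrix.mulVec_mulVec, transferZ]

lemma inVec_eq_right (hz : ‖z‖ < 1) (hz0 : z ≠ 0) {n : ℕ} {v : Fin 2 → ℂ}
    (hv : transferZ α lam z n *ᵥ v = outVec α lam z (resolventVec α lam z n) n) (k : ℕ)
    (hk : n + 1 ≤ k) :
    inVec α lam z (resolventVec α lam z n) k = transferZ α lam z k *ᵥ v := by
  induction k, hk using Nat.le_induction with
  | base => rw [inVec_succ α lam hz0, ← hv, Matrix.mulVec_mulVec, transferZ]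
  | succ k hk ih =>
    rw [inVec_succ α lam hz0, ← inVec_eq_outVec α lam hz hz0 (by omega), ih,
      Matrix.mulVec_mulVec, transferZ]

lemma tendsto_coe_zero (f : Ell2) : Tendsto (fun k => (f : ℕ → ℂ) k) atTop (𝓝 0) := by
  have h : Summable (fun n => ‖f n‖ ^ 2) := by
    simpa using (lp.memℓp f).summable (by norm_num)
  have h1 := h.tendsto_atTop_zero
  rw [tendsto_zero_iff_norm_tendsto_zero]
  have h2 := (Real.continuous_sqrt.tendsto 0).comp h1
  simpa [Function.comp_def, Real.sqrt_sq] using h2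

lemma tendsto_inVec (z : ℂ) (f : Ell2) :
    Tendsto (fun k => inVec α lam z f k) atTop (𝓝 0) := by
  have h1 := tendsto_coe_zero f
  have h2 : Tendsto (fun k => seqM α lam f k) atTop (𝓝 0) := tendsto_coe_zero (opM α lam f)
  have h3 : Tendsto (fun k => seqC α lam f k / z) atTop (𝓝 0) := by
    have h := (tendsto_coe_zero ((cmv α lam : Ell2 →L[ℂ] Ell2) f)).div_const z
    rw [zero_div] at h
    exact h
  rw [tendsto_pi_nhds]
  intro i
  fin_cases i
  · have : ∀ k, inVec α lam z f k 0 = if Even k then f k else seqC α lam f k / z := fun k => by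
      unfold inVec; split_ifs <;> rfl
    simp only [Fin.zero_eta, this]
    exact h1.if' h3
  · have : ∀ k, inVec α lam z f k 1 = seqM α lam f k := fun k => by
      unfold inVec; split_ifs <;> rfl
    simp only [Fin.mk_one, this]
    exact h2

/-- To the right of `n` the resolvent vector obeys the recursion and is square summable, hence
decays; the invertible `Z(n)` carries it back to an initial value at site `0`. -/
lemma exists_decays (hz : ‖z‖ < 1) (hz0 : z ≠ 0) (n : ℕ) :
    ∃ v, Decays α lam z v ∧
      transferZ α lam z n *ᵥ v = outVec α lam z (resolventVec α lam z n) n := by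
  have hdet : IsUnit (transferZ α lam z n).det := by
    rw [det_transferZ α lam hz0]
    exact (isUnit_one.neg).pow n
  refine ⟨(transferZ α lam z n)⁻¹ *ᵥ outVec α lam z (resolventVec α lam z n) n, ?_, ?_⟩
  · refine (tendsto_inVec α lam z (resolventVec α lam z n)).congr' ?_
    filter_upwards [eventually_ge_atTop (n + 1)] with k hk
    refine inVec_eq_right α lam hz hz0 ?_ k hk
    rw [Matrix.mulVec_mulVec, Matrix.mul_nonsing_inv _ hdet, Matrix.one_mulVec]
  · rw [Matrix.mulVec_mulVec, Matrix.mul_nonsing_inv _ hdet, Matrix.one_mulVec]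

/-! ### The Schur function -/

/-- For `f = (𝒞 - z)⁻¹ δ₀` unitarity gives `‖z f + δ₀‖ = ‖f‖`, that is `1 + 2 Re (z f₀) = (1 - |z|²)
‖f‖²`, and `‖f‖ ≥ |f₀|`. This is the Schur bound `|s| ≤ 1`. -/
lemma norm_resolventVec_zero_le (hz : ‖z‖ < 1) :
    ‖resolventVec α lam z 0 0‖ ≤ ‖1 + z * resolventVec α lam z 0 0‖ := by
  set f := resolventVec α lam z 0 with hf
  have h := cmv_resolventVec α lam hz 0
  rw [← hf] at h
  have h1 : ‖z • f + delta 0‖ = ‖f‖ := by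
    rw [← h]
    exact ContinuousLinearMap.norm_map_of_mem_unitary (cmv α lam).2 f
  have h2 := norm_add_sq (𝕜 := ℂ) (z • f) (delta 0)
  have h4 : ⟪z • f, delta 0⟫_ℂ = conj (z * f 0) := by
    rw [← inner_conj_symm, inner_delta]
    rfl
  rw [h1, norm_smul, norm_delta, h4] at h2
  have h5 : ‖1 + z * f 0‖ ^ 2 = 1 + 2 * (z * f 0).re + (‖z‖ * ‖f 0‖) ^ 2 := by
    rw [← norm_mul, Complex.sq_norm, Complex.sq_norm, Complex.normSq_apply, Complex.normSq_apply]
    simp only [add_re, one_re, add_im, one_im]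
    ring
  have h6 : ‖f 0‖ ≤ ‖f‖ := lp.norm_apply_le_norm (by norm_num) f 0
  have h7 : RCLike.re (conj (z * f 0)) = (z * f 0).re := by simp
  rw [h7] at h2
  have h8 : ‖z‖ ^ 2 ≤ 1 := by nlinarith [norm_nonneg z]
  have h9 : ‖f 0‖ ^ 2 ≤ ‖f‖ ^ 2 := by gcongr
  refine le_of_sq_le_sq ?_ (norm_nonneg _)
  rw [h5]
  nlinarith

lemma one_add_resolventVec_ne_zero (hz : ‖z‖ < 1) : 1 + z * resolventVec α lam z 0 0 ≠ 0 := by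
  intro h
  have h1 := norm_resolventVec_zero_le α lam hz
  rw [h, norm_zero, norm_le_zero_iff] at h1
  rw [h1] at h
  simp at h

lemma schur_eq (hz : ‖z‖ < 1) (hz0 : z ≠ 0) :
    schur α lam z = resolventVec α lam z 0 0 / (1 + z * resolventVec α lam z 0 0) := by
  have h0 : caratheodory α lam 0 = 1 := by
    rw [caratheodory_eq α lam (by simp)]; simp
  have h1 := one_add_resolventVec_ne_zero α lam hz
  rw [schur, dslope_of_ne _ hz0, slope_def_field, h0, caratheodory_eq α lam hz]
  have h2 : 1 + 2 * z * resolventVec α lam z 0 0 + 1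
      = 2 * (1 + z * resolventVec α lam z 0 0) := by ring
  rw [h2]
  field_simp
  ring

lemma norm_schur_le (hz : ‖z‖ < 1) (hz0 : z ≠ 0) : ‖schur α lam z‖ ≤ 1 := by
  rw [schur_eq α lam hz hz0, norm_div]
  exact div_le_one_of_le₀ (norm_resolventVec_zero_le α lam hz) (norm_nonneg _)

/-- For source site `0` the decaying vector is `((1 + z f₀) / z, f₀)`, and the ratio of its entries
is `z s(z)`. -/
lemma decays_schur (hz : ‖z‖ < 1) (hz0 : z ≠ 0) : Decays α lam z ![1, z * schur α lam z] := by
  obtain ⟨v, hv, h⟩ := exists_decays α lam hz hz0 0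
  rw [transferZ, Matrix.one_mulVec] at h
  have h1 := one_add_resolventVec_ne_zero α lam hz
  convert hv.smul (z / (1 + z * resolventVec α lam z 0 0)) using 1
  have h2 := seqC_resolventVec α lam hz 0 0
  rw [Pi.single_eq_same] at h2
  rw [h, schur_eq α lam hz hz0]
  ext i
  fin_cases i
  · simp [outVec, h2]
    rw [add_comm] at h1
    field_simp
    rw [add_comm 1 (z * _), div_self h1]
  · simp [outVec, seqM_zero]
    ring

/-! ### Diagonal entries of the resolvent -/

/-- The diagonal entries of the resolvent of a half-line CMV matrix in terms of transfer
matrices. -/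
lemma one_add_resolventVec_diag (hz : ‖z‖ < 1) (hz0 : z ≠ 0) (n : ℕ) {w : ℂ}
    (hw : w = z * schur α lam z) {u v : Fin 2 → ℂ} (hu : u = transferZ α lam z n *ᵥ ![1, 1])
    (hv : v = transferZ α lam z n *ᵥ ![1, w]) :
    (1 + 2 * z * resolventVec α lam z n n) * (1 - w) = v 0 * u 1 + v 1 * u 0 := by
  obtain ⟨b, hb, h⟩ := exists_decays α lam hz hz0 n
  have h1 := hb.wedge_eq_zero hz0 (hw ▸ decays_schur α lam hz hz0)
  simp only [Matrix.cons_val_zero, Matrix.cons_val_one, Matrix.cons_val_fin_one, mul_one] at h1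
  have hb' : b = b 0 • ![1, w] := by
    ext i
    fin_cases i
    · simp
    · simp only [Fin.mk_one, Pi.smul_apply, Matrix.cons_val_one, Matrix.cons_val_fin_one,
        smul_eq_mul]
      linear_combination -h1
  rw [hb', Matrix.mulVec_smul, ← hv, outVec_sub_inVec α lam hz hz0,
    inVec_eq_left α lam hz hz0 n n le_rfl, ← hu] at h
  have hdet : v 0 * u 1 - v 1 * u 0 = (-1) ^ n * (1 - w) := by
    have := mulVec_wedge (transferZ α lam z n) ![1, w] ![1, 1]
    rw [← hu, ← hv, det_transferZ α lam hz0] at this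
    simpa using this
  set c := b 0
  set t := resolventVec α lam z n 0 with ht
  have e0 := congrFun h 0
  have e1 := congrFun h 1
  simp only [Pi.smul_apply, Pi.add_apply, smul_eq_mul, Matrix.cons_val_zero, Matrix.cons_val_one,
    Matrix.cons_val_fin_one, add_zero] at e0 e1
  have hin := congrFun (inVec_eq_left α lam hz hz0 n n le_rfl) 0
  rw [← hu, ← ht] at hin
  -- The diagonal entry is the first coordinate of `inVec` for even `n` and of `outVec` for odd `n`.
  -- Accordingly, pairing the jump relation with `v` eliminates `c`, or pairing it with `u`
  -- eliminates `t`.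
  by_cases hn : Even n
  · have hi : inVec α lam z (resolventVec α lam z n) n 0 = resolventVec α lam z n n := by
      simp [inVec, hn]
    rw [hi] at hin
    simp only [Pi.smul_apply, smul_eq_mul] at hin
    rw [hn.neg_one_pow] at hdet e0
    rw [one_mul] at hdet
    have k : z * t * (1 - w) = v 1 := by
      rw [← hdet]
      have : c * v 0 * z = t * u 0 * z + 1 := by rw [e0]; field_simp
      linear_combination (-z * v 0) * e1 + v 1 * this
    rw [hin]
    linear_combination 2 * u 0 * k + (-1 : ℂ) * hdet
  · have hn' := Nat.not_even_iff_odd.1 hn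
    have hi : outVec α lam z (resolventVec α lam z n) n 0 = resolventVec α lam z n n := by
      simp [outVec, hn]
    have hout := congrFun (outVec_sub_inVec α lam hz hz0 n) 0
    rw [inVec_eq_left α lam hz hz0 n n le_rfl, ← hu, ← ht, ← h, hi] at hout
    simp only [Pi.smul_apply, smul_eq_mul] at hout
    rw [hn'.neg_one_pow] at hdet e0
    have k : z * c * (1 - w) = u 1 := by
      have h3 : 1 - w = -(v 0 * u 1 - v 1 * u 0) := by rw [hdet]; ring
      rw [h3]
      have : c * v 0 * z = t * u 0 * z - 1 := by rw [e0]; field_simp; ring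
      linear_combination (z * u 0) * e1 - u 1 * this
    rw [hout]
    linear_combination 2 * v 0 * k + hdet

end CMV
end

noncomputable section
namespace CMV

open scoped Matrix

/-! ### The Floquet form of the resolvent -/

/-- For an eigenvector `(1, w)` of a `2 × 2` matrix of determinant one, the other eigenvector,
normalized such that its determinant with `(1, w)` is one. -/
def dualVec (A : Matrix (Fin 2) (Fin 2) ℂ) (w : ℂ) : Fin 2 → ℂ :=
  (A 1 1 - A 0 0 - 2 * A 0 1 * w)⁻¹ • ![A 0 1, A 1 1 - A 0 0 - A 0 1 * w]

/-- The symmetric pairing `v₀ u₁ + v₁ u₀`. -/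
def pairing (v u : Fin 2 → ℂ) : ℂ := v 0 * u 1 + v 1 * u 0

variable {A : Matrix (Fin 2) (Fin 2) ℂ} {w : ℂ}

/-- The quadratic equation says that `(1, w)` is an eigenvector, with eigenvalue `A 0 0 + A 0 1 *
w`; the other eigenvalue is the trace minus this one. -/
lemma mulVec_dualVec (h : A 0 1 * w ^ 2 + (A 0 0 - A 1 1) * w - A 1 0 = 0) :
    A *ᵥ dualVec A w = (A 1 1 - A 0 1 * w) • dualVec A w := by
  rw [dualVec, Matrix.mulVec_smul, smul_comm]
  congr 1
  ext i
  fin_cases i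
  · simp [Matrix.mulVec, dotProduct, Fin.sum_univ_two]
    ring
  · simp [Matrix.mulVec, dotProduct, Fin.sum_univ_two]
    linear_combination -A 0 1 * h

lemma eigenvalue_mul (hA : A.det = 1) (h : A 0 1 * w ^ 2 + (A 0 0 - A 1 1) * w - A 1 0 = 0) :
    (A 0 0 + A 0 1 * w) * (A 1 1 - A 0 1 * w) = 1 := by
  rw [Matrix.det_fin_two] at hA
  linear_combination hA - A 0 1 * h

lemma eq_add_dualVec (hD : A 1 1 - A 0 0 - 2 * A 0 1 * w ≠ 0) :
    (![1, 1] : Fin 2 → ℂ) =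
      (1 - (1 - w) * A 0 1 / (A 1 1 - A 0 0 - 2 * A 0 1 * w)) • ![1, w] + (1 - w) • dualVec A w := by
  have h : A 1 1 - A 0 0 - A 0 1 * w = A 1 1 - A 0 0 - 2 * A 0 1 * w + A 0 1 * w := by ring
  rw [dualVec, h]
  generalize A 1 1 - A 0 0 - 2 * A 0 1 * w = D at hD
  ext i
  fin_cases i
  · simp
    field_simp
    ring
  · simp
    field_simp
    ring

lemma pow_mulVec_of_eigen {v : Fin 2 → ℂ} {c : ℂ} (h : A *ᵥ v = c • v) (m : ℕ) :
    A ^ m *ᵥ v = c ^ m • v := by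
  induction m with
  | zero => simp
  | succ m ih => rw [pow_succ', ← Matrix.mulVec_mulVec, ih, Matrix.mulVec_smul, h, smul_smul, pow_succ]

variable {q : ℕ} {α : ℕ → UnitDisc} {lam : ℕ → Circle} {z : ℂ}

/-- The decaying initial value is an eigenvector of the monodromy matrix with eigenvalue in the
open unit disc. -/
lemma Decays.monodromy (hq0 : 0 < q) (hq : Even q) (hα : ∀ n, α (n + q) = α n)
    (hlam : ∀ n, lam (n + q) = lam n) (hz : z ≠ 0) (hw : Decays α lam z ![1, w]) :
    (transferZ α lam z q) 0 1 * w ^ 2 + ((transferZ α lam z q) 0 0 - (transferZ α lam z q) 1 1) * w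
        - (transferZ α lam z q) 1 0 = 0 ∧
      ‖(transferZ α lam z q) 0 0 + (transferZ α lam z q) 0 1 * w‖ < 1 := by
  set Φ := transferZ α lam z q with hΦ
  have h1 := hw.shift hq
  -- After a full period the recursion is the same, so `Φ (1, w)` is again a decaying initial value
  -- and hence parallel to `(1, w)`.
  simp only [hα, hlam] at h1
  have h2 := h1.wedge_eq_zero hz hw
  have h3 : Φ 0 1 * w ^ 2 + (Φ 0 0 - Φ 1 1) * w - Φ 1 0 = 0 := by
    simp [Matrix.mulVec, dotProduct, Fin.sum_univ_two, ← hΦ] at h2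
    linear_combination h2
  refine ⟨h3, ?_⟩
  set ζ := Φ 0 0 + Φ 0 1 * w with hζ
  have h4 : Φ *ᵥ ![1, w] = ζ • ![1, w] := by
    ext i
    fin_cases i
    · simp [Matrix.mulVec, dotProduct, Fin.sum_univ_two, hζ]
    · simp [Matrix.mulVec, dotProduct, Fin.sum_univ_two, hζ]
      linear_combination -h3
  have h5 : Tendsto (fun m : ℕ => q * m) atTop atTop :=
    tendsto_id.const_mul_atTop' hq0
  have h6 := tendsto_pi_nhds.1 (hw.comp h5) 0
  have h7 : ∀ m, (transferZ α lam z (q * m) *ᵥ ![1, w]) 0 = ζ ^ m := fun m => by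
    have := transferZ_add_mul α lam hq hα hlam z 0 m
    rw [zero_add, transferZ, one_mul, ← hΦ] at this
    rw [this, pow_mulVec_of_eigen h4]
    simp
  simp only [Function.comp_apply, h7, Pi.zero_apply] at h6
  exact tendsto_pow_atTop_nhds_zero_iff_norm_lt_one.1 h6

/-- The limit, along the residue class of `r` modulo the period, of the diagonal entries of
`(𝒞 + z) (𝒞 - z)⁻¹`. -/
def diagLimit (α : ℕ → UnitDisc) (lam : ℕ → Circle) (q : ℕ) (z w : ℂ) (r : ℕ) : ℂ :=
  pairing (transferZ α lam z r *ᵥ ![1, w])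
    (transferZ α lam z r *ᵥ dualVec (transferZ α lam z q) w)

lemma tendsto_resolventVec_diag (hq0 : 0 < q) (hq : Even q) (hα : ∀ n, α (n + q) = α n)
    (hlam : ∀ n, lam (n + q) = lam n) (hz : ‖z‖ < 1) (hz0 : z ≠ 0) (r : ℕ) :
    Tendsto (fun m => 1 + 2 * z * resolventVec α lam z (r + q * m) (r + q * m)) atTop
      (𝓝 (diagLimit α lam q z (z * schur α lam z) r)) := by
  set w := z * schur α lam z with hw
  set Φ := transferZ α lam z q with hΦ
  obtain ⟨hquad, hζ1⟩ := (decays_schur α lam hz hz0).monodromy hq0 hq hα hlam hz0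
  rw [← hw, ← hΦ] at hquad hζ1
  have hdet : Φ.det = 1 := by rw [hΦ, det_transferZ α lam hz0, hq.neg_one_pow]
  have hmul := eigenvalue_mul hdet hquad
  set ζ := Φ 0 0 + Φ 0 1 * w with hζ
  set η := Φ 1 1 - Φ 0 1 * w with hη
  -- This is `η - ζ`; since `ζ η = 1` and `|ζ| < 1` the eigenvalues differ.
  have hD : Φ 1 1 - Φ 0 0 - 2 * Φ 0 1 * w ≠ 0 := by
    intro h0
    have h1 : η = ζ := by rw [hη, hζ]; linear_combination h0
    rw [h1] at hmul
    have := congrArg norm hmul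
    rw [norm_mul, norm_one] at this
    nlinarith [norm_nonneg ζ]
  have hw1 : 1 - w ≠ 0 := by
    intro h0
    have h1 : w = 1 := (sub_eq_zero.1 h0).symm
    have h2 := norm_schur_le α lam hz hz0
    have h3 := congrArg norm h1
    rw [hw, norm_mul, norm_one] at h3
    nlinarith [norm_nonneg z, norm_nonneg (schur α lam z)]
  have hv : Φ *ᵥ ![1, w] = ζ • ![1, w] := by
    ext i
    fin_cases i
    · simp [Matrix.mulVec, dotProduct, Fin.sum_univ_two, hζ]
    · simp [Matrix.mulVec, dotProduct, Fin.sum_univ_two, hζ]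
      linear_combination -hquad
  have hE : Φ *ᵥ dualVec Φ w = η • dualVec Φ w := mulVec_dualVec hquad
  set κ := 1 - (1 - w) * Φ 0 1 / (Φ 1 1 - Φ 0 0 - 2 * Φ 0 1 * w)
  set V := transferZ α lam z r *ᵥ ![1, w] with hV
  set W := transferZ α lam z r *ᵥ dualVec Φ w with hW
  -- After `m` periods the decaying solution carries `ζ ^ m`. Against the growing part of the other
  -- solution this gives `ζ ^ m * η ^ m = 1`, against the decaying part `ζ ^ (2m)`.
  have key : ∀ m, 1 + 2 * z * resolventVec α lam z (r + q * m) (r + q * m)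
      = (1 - w)⁻¹ * (κ * pairing V V) * (ζ ^ 2) ^ m + pairing V W := by
    intro m
    have h1 := one_add_resolventVec_diag α lam hz hz0 (r + q * m) hw rfl rfl
    have hv' : transferZ α lam z (r + q * m) *ᵥ ![1, w] = ζ ^ m • V := by
      rw [transferZ_add_mul α lam hq hα hlam, ← Matrix.mulVec_mulVec, pow_mulVec_of_eigen hv,
        Matrix.mulVec_smul]
    have hu' : transferZ α lam z (r + q * m) *ᵥ ![1, 1]
        = (κ * ζ ^ m) • V + ((1 - w) * η ^ m) • W := by
      rw [transferZ_add_mul α lam hq hα hlam, eq_add_dualVec hD, ← Matrix.mulVec_mulVec,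
        Matrix.mulVec_add, Matrix.mulVec_smul, Matrix.mulVec_smul, pow_mulVec_of_eigen hv,
        pow_mulVec_of_eigen hE, Matrix.mulVec_add]
      simp only [Matrix.mulVec_smul, smul_smul]
      rfl
    rw [hv', hu'] at h1
    have h2 : ζ ^ m * η ^ m = 1 := by rw [← mul_pow, hmul, one_pow]
    simp only [Pi.smul_apply, Pi.add_apply, smul_eq_mul] at h1
    apply mul_right_cancel₀ hw1
    rw [h1]
    simp only [pairing]
    clear_value ζ η κ V W
    field_simp
    linear_combination (1 - w) * (V 0 * W 1 + V 1 * W 0) * h2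
  simp only [key]
  have h8 : Tendsto (fun m : ℕ => (ζ ^ 2) ^ m) atTop (𝓝 0) := by
    refine tendsto_pow_atTop_nhds_zero_iff_norm_lt_one.2 ?_
    rw [norm_pow]
    nlinarith [norm_nonneg ζ]
  have h9 := (h8.const_mul ((1 - w)⁻¹ * (κ * pairing V V))).add_const (pairing V W)
  rw [mul_zero, zero_add] at h9
  exact h9

/-- The Herglotz integral of the density of states measure in terms of transfer matrices. -/
lemma herglotz_densityOfStates (hq0 : 0 < q) (hq : Even q) (hα : ∀ n, α (n + q) = α n)
    (hlam : ∀ n, lam (n + q) = lam n) {ν : Measure ℂ} (hν : IsDensityOfStates (cmv α lam) ν)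
    (hz : ‖z‖ < 1) (hz0 : z ≠ 0) :
    ∫ w, (w + z) / (w - z) ∂ν =
      (q : ℂ)⁻¹ * ∑ r ∈ Finset.range q, diagLimit α lam q z (z * schur α lam z) r := by
  have := hν.isProb
  have h1 := hasSum_herglotz ν hν.onCircle hz
  have h2 := tendsto_average_of_residues hq0
    (a := fun n => 1 + 2 * z * resolventVec α lam z n n) (fun r _ =>
    tendsto_resolventVec_diag hq0 hq hα hlam hz hz0 r)
  have hmom := fun k => (tendsto_moments_iff α lam k _).1 (hν.moments k)
  set avg : ℕ → ℕ → ℂ := fun N k => (N : ℂ)⁻¹ * ∑ n ∈ Finset.range N, diagPow α lam k n with havg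
  have h3 : ∀ N : ℕ, HasSum (fun k : ℕ => 2 * z ^ (k + 1) * conj (avg N (k + 1)))
      ((N : ℂ)⁻¹ * ∑ n ∈ Finset.range N, 2 * z * resolventVec α lam z n n) := by
    intro N
    have h4 := (hasSum_sum fun n (_ : n ∈ Finset.range N) =>
      (hasSum_resolventVec α lam hz n).mul_left (2 * z)).mul_left (N : ℂ)⁻¹
    have e : ∀ k : ℕ, 2 * z ^ (k + 1) * conj (avg N (k + 1)) = (N : ℂ)⁻¹ *
        ∑ n ∈ Finset.range N, 2 * z * (z ^ k * conj (diagPow α lam (k + 1) n)) := by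
      intro k
      simp only [havg, map_mul, map_inv₀, map_natCast, map_sum, ← Finset.mul_sum]
      ring
    simpa only [e] using h4
  have h5 : Tendsto (fun N : ℕ => (N : ℂ)⁻¹ * ∑ n ∈ Finset.range N,
      2 * z * resolventVec α lam z n n) atTop (𝓝 (∫ w, (w + z) / (w - z) ∂ν - 1)) := by
    have h6 : Tendsto (fun N : ℕ => ∑' k : ℕ, 2 * z ^ (k + 1) * conj (avg N (k + 1))) atTop
        (𝓝 (∑' k : ℕ, 2 * z ^ (k + 1) * conj (∫ w, w ^ (k + 1) ∂ν))) := by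
      refine tendsto_tsum_of_dominated_convergence (bound := fun k => 2 * ‖z‖ ^ (k + 1))
        (((summable_nat_add_iff 1).2
          (summable_geometric_of_lt_one (norm_nonneg z) hz)).mul_left 2) (fun k => ?_)
        (Eventually.of_forall fun N k => ?_)
      · exact ((Complex.continuous_conj.tendsto _).comp (hmom (k + 1))).const_mul _
      · rw [norm_mul, RCLike.norm_conj, norm_mul, norm_pow, Complex.norm_ofNat]
        refine mul_le_of_le_one_right (by positivity) ?_
        rw [havg, norm_mul, norm_inv, Complex.norm_natCast]
        refine (mul_le_mul_of_nonneg_left (norm_sum_le_of_le _ fun n _ =>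
          norm_diagPow_le α lam (k + 1) n) (by positivity)).trans ?_
        rw [Finset.sum_const, Finset.card_range, nsmul_eq_mul, mul_one]
        exact inv_mul_le_one
    rw [h1.tsum_eq] at h6
    exact h6.congr fun N => (h3 N).tsum_eq
  have h7 : Tendsto (fun N : ℕ => (N : ℂ)⁻¹ * ∑ n ∈ Finset.range N,
      (1 + 2 * z * resolventVec α lam z n n)) atTop (𝓝 (∫ w, (w + z) / (w - z) ∂ν)) := by
    have h8 := h5.const_add 1
    rw [add_sub_cancel] at h8
    refine h8.congr' ?_
    filter_upwards [eventually_gt_atTop 0] with N hN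
    have : (N : ℂ) ≠ 0 := by exact_mod_cast hN.ne'
    rw [Finset.sum_add_distrib, Finset.sum_const, Finset.card_range, nsmul_eq_mul]
    field_simp
  exact tendsto_nhds_unique h7 h2

end CMV
end

noncomputable section
namespace CMV

open scoped Matrix

/-! ### Elliptic matrices -/

section Elliptic

variable {a b w : ℂ}

lemma elliptic_mul_conj (h : b * w ^ 2 + (a - conj a) * w - conj b = 0) :
    b * w * (w * conj w) + (a - conj a) * (w * conj w) - conj (b * w) = 0 := by
  rw [map_mul]
  linear_combination conj w * h

/-- After multiplication by `conj w`, the real part of the equation is `Re (b w) (|w|² - 1) = 0`. -/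
lemma elliptic_re_mul (h : b * w ^ 2 + (a - conj a) * w - conj b = 0) (hw : ‖w‖ ≠ 1) :
    (b * w).re = 0 := by
  have h1 := congrArg Complex.re (elliptic_mul_conj h)
  rw [Complex.mul_conj] at h1
  simp only [sub_re, add_re, re_mul_ofReal, conj_re, sub_self, zero_mul, add_zero, zero_re] at h1
  have h2 : Complex.normSq w - 1 ≠ 0 := by
    intro h3
    apply hw
    rw [Complex.normSq_eq_norm_sq] at h3
    have h4 : ‖w‖ ^ 2 = 1 := by linarith
    nlinarith [norm_nonneg w]
  have h5 : (b * w).re * (Complex.normSq w - 1) = 0 := by linarith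
  exact (mul_eq_zero.1 h5).resolve_right h2

/-- For `|w| = 1` the imaginary part gives `|Im a| = |Im (b w)| ≤ |b|`, and the determinant
condition then forces `|Re a| ≥ 1`. -/
lemma elliptic_norm_ne_one (h : b * w ^ 2 + (a - conj a) * w - conj b = 0)
    (hdet : ‖a‖ ^ 2 - ‖b‖ ^ 2 = 1) (ha : |a.re| < 1) : ‖w‖ ≠ 1 := by
  intro hw
  have h1 := congrArg Complex.im (elliptic_mul_conj h)
  rw [Complex.mul_conj, Complex.normSq_eq_norm_sq, hw] at h1
  simp at h1
  have h2 : a.im = -(b * w).im := by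
    simp only [mul_im]
    linarith
  have h3 := Complex.abs_im_le_norm (b * w)
  rw [norm_mul, hw, mul_one] at h3
  have h4 : a.im ^ 2 ≤ ‖b‖ ^ 2 := by
    rw [h2, neg_sq, ← sq_abs]
    gcongr
  have h5 : a.re ^ 2 < 1 := (sq_lt_one_iff_abs_lt_one _).2 ha
  rw [Complex.sq_norm, Complex.normSq_apply] at hdet
  nlinarith

/-- If `b ≠ 0`, distinct roots have product `-conj b / b` of modulus one, so they cannot both lie in
the disc. If `b = 0`, then `a` is real of modulus one, contradicting `|Re a| < 1`. -/
lemma elliptic_unique {w' : ℂ} (h : b * w ^ 2 + (a - conj a) * w - conj b = 0)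
    (h' : b * w' ^ 2 + (a - conj a) * w' - conj b = 0)
    (hdet : ‖a‖ ^ 2 - ‖b‖ ^ 2 = 1) (ha : |a.re| < 1) (hw : ‖w‖ < 1) (hw' : ‖w'‖ < 1) : w = w' := by
  by_contra hne
  have h1 : b * (w + w') + (a - conj a) = 0 := by
    apply mul_right_cancel₀ (sub_ne_zero.2 hne)
    linear_combination h - h'
  have h2 : conj b = -(b * (w * w')) := by linear_combination w * h1 - h
  have h3 := congrArg norm h2
  rw [RCLike.norm_conj, norm_neg, norm_mul, norm_mul] at h3
  have h4 : ‖w‖ * ‖w'‖ < 1 := by nlinarith [norm_nonneg w, norm_nonneg w']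
  have h5 : ‖b‖ = 0 := by nlinarith [norm_nonneg b]
  rw [norm_eq_zero] at h5
  rw [h5] at h1 hdet
  have h6 : a.im = 0 := by
    have := congrArg Complex.im h1
    simp at this
    linarith
  rw [Complex.sq_norm, Complex.normSq_apply, h6] at hdet
  have h7 : a.re ^ 2 < 1 := (sq_lt_one_iff_abs_lt_one _).2 ha
  simp at hdet
  nlinarith

lemma elliptic_dual_ne_zero (h : b * w ^ 2 + (a - conj a) * w - conj b = 0)
    (hdet : ‖a‖ ^ 2 - ‖b‖ ^ 2 = 1) (ha : |a.re| < 1) (hw : ‖w‖ < 1) :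
    conj a - a - 2 * b * w ≠ 0 := by
  intro h0
  have h1 : b * w ^ 2 + conj b = 0 := by linear_combination -h - w * h0
  have h3 := congrArg norm (eq_neg_of_add_eq_zero_right h1)
  rw [RCLike.norm_conj, norm_neg, norm_mul, norm_pow] at h3
  have h4 : ‖w‖ ^ 2 < 1 := by nlinarith [norm_nonneg w]
  have h5 : ‖b‖ = 0 := by nlinarith [norm_nonneg b]
  rw [norm_eq_zero] at h5
  rw [h5] at h0 hdet
  have h6 : a.im = 0 := by
    have := congrArg Complex.im h0
    simp at this
    linarith
  rw [Complex.sq_norm, Complex.normSq_apply, h6] at hdet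
  have h7 : a.re ^ 2 < 1 := (sq_lt_one_iff_abs_lt_one _).2 ha
  simp at hdet
  nlinarith

/-- The two eigenvectors of an elliptic element of `SU(1,1)` are reflections of each other. -/
lemma elliptic_dualVec {A : Matrix (Fin 2) (Fin 2) ℂ} (h1 : A 1 1 = conj (A 0 0))
    (h2 : A 1 0 = conj (A 0 1))
    (h : A 0 1 * w ^ 2 + (A 0 0 - A 1 1) * w - A 1 0 = 0) (hdet : ‖A 0 0‖ ^ 2 - ‖A 0 1‖ ^ 2 = 1)
    (ha : |(A 0 0).re| < 1) (hw : ‖w‖ < 1) :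
    dualVec A w = ((1 - ‖w‖ ^ 2 : ℝ) : ℂ)⁻¹ • ![conj w, 1] := by
  rw [h1, h2] at h
  have hD := elliptic_dual_ne_zero h hdet ha hw
  have hre := elliptic_re_mul h hw.ne
  have hc : conj (A 0 1) * conj w = -(A 0 1 * w) := by
    rw [← map_mul]
    apply Complex.ext <;> simp [hre]
    · simpa using hre
    · ring
  have hk : (1 : ℂ) - w * conj w ≠ 0 := by
    rw [Complex.mul_conj']
    have : (1 : ℝ) - ‖w‖ ^ 2 ≠ 0 := by nlinarith [norm_nonneg w]
    exact_mod_cast this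
  have hn : ((1 - ‖w‖ ^ 2 : ℝ) : ℂ) = 1 - w * conj w := by
    rw [Complex.mul_conj']; push_cast; ring
  have hconj := congrArg conj h
  simp only [map_sub, map_add, map_mul, map_pow, Complex.conj_conj, map_zero] at hconj
  rw [dualVec, hn, h1]
  ext i
  fin_cases i
  · simp
    field_simp
    linear_combination conj w * hc - hconj
  · simp
    field_simp
    linear_combination conj w * h + hc

end Elliptic

/-! ### Transfer matrices on the unit circle -/

variable {α : ℕ → UnitDisc} {lam : ℕ → Circle} {z : ℂ} {q : ℕ}

lemma transferZ_conj (hz : ‖z‖ = 1) (n : ℕ) :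
    transferZ α lam z n 1 1 = conj (transferZ α lam z n 0 0) ∧
      transferZ α lam z n 1 0 = conj (transferZ α lam z n 0 1) := by
  have hzi : conj z = z⁻¹ := by rw [Complex.inv_def, Complex.normSq_eq_norm_sq, hz]; simp
  have hY : ∀ k, transferY α lam z k 1 1 = conj (transferY α lam z k 0 0) ∧
      transferY α lam z k 1 0 = conj (transferY α lam z k 0 1) := by
    intro k
    have hl : conj (lam k : ℂ) = (lam k : ℂ)⁻¹ := by
      rw [Complex.inv_def, Complex.normSq_eq_norm_sq, Circle.norm_coe]; simp
    unfold transferY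
    split_ifs
    · simp [transferQ, hl, hzi]
    · simp [transferP, hl]
  induction n with
  | zero => simp [transferZ]
  | succ n ih =>
    obtain ⟨h1, h2⟩ := ih
    obtain ⟨h3, h4⟩ := hY n
    simp only [transferZ, Matrix.mul_apply, Fin.sum_univ_two, h1, h2, h3, h4, map_add, map_mul,
      Complex.conj_conj]
    exact ⟨by ring, by ring⟩

lemma transferZ_norm_sq (hz : ‖z‖ = 1) (n : ℕ) :
    ‖transferZ α lam z n 0 0‖ ^ 2 - ‖transferZ α lam z n 0 1‖ ^ 2 = (-1) ^ n := by
  have hz0 : z ≠ 0 := fun h => by simp [h] at hz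
  have h := det_transferZ α lam hz0 n
  obtain ⟨h1, h2⟩ := transferZ_conj (α := α) (lam := lam) hz n
  rw [Matrix.det_fin_two, h1, h2, Complex.mul_conj', Complex.mul_conj'] at h
  exact_mod_cast h

/-- On the circle the rows of `Z(n)` are `(a, b)` and `(conj b, conj a)` with `|a|² - |b|² =
(-1)^n`. -/
lemma transferZ_form (hz : ‖z‖ = 1) (n : ℕ) (x : ℂ) :
    ‖(transferZ α lam z n *ᵥ ![1, x]) 0‖ ^ 2 - ‖(transferZ α lam z n *ᵥ ![1, x]) 1‖ ^ 2
      = (-1) ^ n * (1 - ‖x‖ ^ 2) := by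
  have h := transferZ_norm_sq (α := α) (lam := lam) hz n
  obtain ⟨h1, h2⟩ := transferZ_conj (α := α) (lam := lam) hz n
  apply Complex.ofReal_injective
  have h' := congrArg (fun x : ℝ => (x : ℂ)) h
  push_cast at h' ⊢
  simp only [← Complex.mul_conj'] at h' ⊢
  simp only [Matrix.mulVec, dotProduct, Fin.sum_univ_two, h1, h2, Matrix.cons_val_zero,
    Matrix.cons_val_one, Matrix.cons_val_fin_one, map_add, map_mul, Complex.conj_conj, map_one]
  linear_combination (1 - x * conj x) * h'

lemma discriminant_eq (hz : ‖z‖ = 1) :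
    discriminant q α lam z = ((2 * (transferZ α lam z q 0 0).re : ℝ) : ℂ) := by
  rw [discriminant, Matrix.trace_fin_two, (transferZ_conj hz q).1, Complex.add_conj]

lemma discriminant_mem_iff (hz : ‖z‖ = 1) :
    discriminant q α lam z ∈ (fun x : ℝ => (x : ℂ)) '' Set.Ioo (-2) 2 ↔
      |(transferZ α lam z q 0 0).re| < 1 := by
  rw [discriminant_eq hz, abs_lt]
  constructor
  · rintro ⟨x, hx, h⟩
    have : x = 2 * (transferZ α lam z q 0 0).re := Complex.ofReal_injective h
    exact ⟨by linarith [hx.1], by linarith [hx.2]⟩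
  · rintro ⟨h1, h2⟩
    exact ⟨_, ⟨by linarith, by linarith⟩, rfl⟩

lemma continuousAt_transferZ (hz : z ≠ 0) (n : ℕ) :
    ContinuousAt (fun z => transferZ α lam z n) z := by
  induction n with
  | zero => exact continuousAt_const
  | succ n ih =>
    refine ContinuousAt.mul ?_ ih
    unfold transferY
    split_ifs
    · refine continuousAt_pi.2 fun i => continuousAt_pi.2 fun j => ?_
      have hinv := continuousAt_inv₀ hz
      fin_cases i <;> fin_cases j <;> simp [transferQ] <;> fun_prop (disch := assumption)
    · exact continuousAt_const

lemma continuousAt_transferZ_apply (hz : z ≠ 0) (n : ℕ) (i j : Fin 2) :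
    ContinuousAt (fun z => transferZ α lam z n i j) z :=
  continuousAt_pi.1 (continuousAt_pi.1 (continuousAt_transferZ hz n) i) j

lemma eventually_ball (hz : ‖z‖ = 1) :
    ∀ᶠ x in 𝓝[Metric.ball (0 : ℂ) 1] z, ‖x‖ < 1 ∧ x ≠ 0 := by
  have hz0 : z ≠ 0 := fun h => by simp [h] at hz
  filter_upwards [self_mem_nhdsWithin, nhdsWithin_le_nhds (isOpen_ne.mem_nhds hz0)] with x hx hx0
  exact ⟨by simpa using hx, hx0⟩

lemma neBot_nhdsWithin_ball (hz : ‖z‖ = 1) : (𝓝[Metric.ball (0 : ℂ) 1] z).NeBot := by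
  rw [← mem_closure_iff_nhdsWithin_neBot, closure_ball _ one_ne_zero]
  simp [hz]

/-- Boundary values of the Schur function of a periodic CMV matrix in the bands. -/
lemma exists_tendsto_schur (hq0 : 0 < q) (hq : Even q) (hα : ∀ n, α (n + q) = α n)
    (hlam : ∀ n, lam (n + q) = lam n) (hz : ‖z‖ = 1) (hΔ : |(transferZ α lam z q 0 0).re| < 1) :
    ∃ w, Tendsto (fun x => x * schur α lam x) (𝓝[Metric.ball (0 : ℂ) 1] z) (𝓝 w) ∧ ‖w‖ < 1 ∧
      transferZ α lam z q 0 1 * w ^ 2 +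
        (transferZ α lam z q 0 0 - transferZ α lam z q 1 1) * w - transferZ α lam z q 1 0 = 0 := by
  have hz0 : z ≠ 0 := fun h => by simp [h] at hz
  have hne := neBot_nhdsWithin_ball hz
  set l := 𝓝[Metric.ball (0 : ℂ) 1] z with hl
  set W : ℂ → ℂ := fun x => x * schur α lam x with hW
  obtain ⟨h1, h2⟩ := transferZ_conj (α := α) (lam := lam) hz q
  have hdet := transferZ_norm_sq (α := α) (lam := lam) hz q
  rw [hq.neg_one_pow] at hdet
  have hK : ∀ᶠ x in l, W x ∈ Metric.closedBall (0 : ℂ) 1 := by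
    filter_upwards [eventually_ball hz] with x hx
    rw [mem_closedBall_zero_iff, hW, norm_mul]
    exact mul_le_one₀ hx.1.le (norm_nonneg _) (norm_schur_le α lam hx.1 hx.2)
  -- Convergence comes from compactness: every cluster point satisfies the limiting quadratic
  -- equation and cannot have modulus one, and that equation has only one root in the open disc.
  have hroot : ∀ y, MapClusterPt y l W → transferZ α lam z q 0 1 * y ^ 2 +
      (transferZ α lam z q 0 0 - transferZ α lam z q 1 1) * y - transferZ α lam z q 1 0 = 0 := by
    intro y hy
    obtain ⟨U, hU, hUy⟩ := mapClusterPt_iff_ultrafilter.1 hy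
    have hZ : ∀ i j, Tendsto (fun x => transferZ α lam x q i j) U (𝓝 (transferZ α lam z q i j)) :=
      fun i j => (continuousAt_transferZ_apply hz0 q i j).tendsto.mono_left
        (hU.trans nhdsWithin_le_nhds)
    have ht := (((hZ 0 1).mul (hUy.pow 2)).add (((hZ 0 0).sub (hZ 1 1)).mul hUy)).sub (hZ 1 0)
    refine tendsto_nhds_unique ht (tendsto_const_nhds.congr' ?_)
    filter_upwards [hU (eventually_ball hz)] with x hx
    exact (((decays_schur α lam hx.1 hx.2).monodromy hq0 hq hα hlam hx.2).1).symm
  have hlt : ∀ y ∈ Metric.closedBall (0 : ℂ) 1, MapClusterPt y l W → ‖y‖ < 1 := by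
    intro y hy hc
    have h := hroot y hc
    rw [h1, h2] at h
    exact lt_of_le_of_ne (by simpa using hy) (elliptic_norm_ne_one h hdet hΔ)
  obtain ⟨w, hwK, hw⟩ := (isCompact_closedBall (0 : ℂ) 1).exists_mapClusterPt_of_frequently
    hK.frequently
  refine ⟨w, ?_, hlt w hwK hw, hroot w hw⟩
  refine (isCompact_closedBall (0 : ℂ) 1).tendsto_nhds_of_unique_mapClusterPt hK fun y hy hc => ?_
  have e1 := hroot y hc
  have e2 := hroot w hw
  rw [h1, h2] at e1 e2
  exact elliptic_unique e1 e2 hdet hΔ (hlt y hy hc) (hlt w hwK hw)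

/-- The boundary value of `diagLimit` in the bands. -/
lemma diagLimit_boundary (hq : Even q) (hz : ‖z‖ = 1) (hΔ : |(transferZ α lam z q 0 0).re| < 1)
    {w : ℂ} (hw : ‖w‖ < 1) (h : transferZ α lam z q 0 1 * w ^ 2 +
      (transferZ α lam z q 0 0 - transferZ α lam z q 1 1) * w - transferZ α lam z q 1 0 = 0)
    (r : ℕ) :
    diagLimit α lam q z w r = (((‖(transferZ α lam z r *ᵥ ![1, w]) 0‖ ^ 2 +
      ‖(transferZ α lam z r *ᵥ ![1, w]) 1‖ ^ 2) / (1 - ‖w‖ ^ 2) : ℝ) : ℂ) := by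
  obtain ⟨h1, h2⟩ := transferZ_conj (α := α) (lam := lam) hz q
  obtain ⟨h3, h4⟩ := transferZ_conj (α := α) (lam := lam) hz r
  have hdet := transferZ_norm_sq (α := α) (lam := lam) hz q
  rw [hq.neg_one_pow] at hdet
  rw [diagLimit, elliptic_dualVec h1 h2 h hdet hΔ hw, Matrix.mulVec_smul, pairing]
  rw [Complex.ofReal_div]
  push_cast
  simp only [← Complex.mul_conj']
  simp only [Pi.smul_apply, smul_eq_mul, Matrix.mulVec, dotProduct, Fin.sum_univ_two, h3, h4,
    Matrix.cons_val_zero, Matrix.cons_val_one, Matrix.cons_val_fin_one, map_add, map_mul,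
    Complex.conj_conj, map_one]
  ring

lemma tendsto_diagLimit {w : ℂ} {W : ℂ → ℂ} (hz0 : z ≠ 0)
    (hD : transferZ α lam z q 1 1 - transferZ α lam z q 0 0 - 2 * transferZ α lam z q 0 1 * w ≠ 0)
    {l : Filter ℂ} (hl : l ≤ 𝓝 z) (hW : Tendsto W l (𝓝 w)) (r : ℕ) :
    Tendsto (fun x => diagLimit α lam q x (W x) r) l (𝓝 (diagLimit α lam q z w r)) := by
  have hZ : ∀ n i j, Tendsto (fun x => transferZ α lam x n i j) l (𝓝 (transferZ α lam z n i j)) :=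
    fun n i j => (continuousAt_transferZ_apply hz0 n i j).tendsto.mono_left hl
  have hDt := ((((hZ q 1 1).sub (hZ q 0 0)).sub (((hZ q 0 1).const_mul 2).mul hW))).inv₀ hD
  have hE0 := hDt.mul (hZ q 0 1)
  have hE1 := hDt.mul (((hZ q 1 1).sub (hZ q 0 0)).sub ((hZ q 0 1).mul hW))
  simp only [diagLimit, pairing, dualVec, Matrix.mulVec, dotProduct, Fin.sum_univ_two,
    Matrix.cons_val_zero, Matrix.cons_val_one, Matrix.cons_val_fin_one, Pi.smul_apply, smul_eq_mul,
    mul_one]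
  exact (((hZ r 0 0).add ((hZ r 0 1).mul hW)).mul
      (((hZ r 1 0).mul hE0).add ((hZ r 1 1).mul hE1))).add
    (((hZ r 1 0).add ((hZ r 1 1).mul hW)).mul (((hZ r 0 0).mul hE0).add ((hZ r 0 1).mul hE1)))

/-- Boundary values of the Poisson integral of the density of states measure in the bands. -/
lemma tendsto_poissonIntegral_densityOfStates (hq0 : 0 < q) (hq : Even q)
    (hα : ∀ n, α (n + q) = α n) (hlam : ∀ n, lam (n + q) = lam n) {ν : Measure ℂ}
    (hν : IsDensityOfStates (cmv α lam) ν) (hz : ‖z‖ = 1)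
    (hΔ : |(transferZ α lam z q 0 0).re| < 1) {w : ℂ}
    (hW : Tendsto (fun x => x * schur α lam x) (𝓝[Metric.ball (0 : ℂ) 1] z) (𝓝 w)) (hw : ‖w‖ < 1)
    (h : transferZ α lam z q 0 1 * w ^ 2 +
      (transferZ α lam z q 0 0 - transferZ α lam z q 1 1) * w - transferZ α lam z q 1 0 = 0) :
    Tendsto (poissonIntegral ν) (𝓝[Metric.ball (0 : ℂ) 1] z)
      (𝓝 ((q : ℝ)⁻¹ * ∑ r ∈ Finset.range q, (‖(transferZ α lam z r *ᵥ ![1, w]) 0‖ ^ 2 +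
        ‖(transferZ α lam z r *ᵥ ![1, w]) 1‖ ^ 2) / (1 - ‖w‖ ^ 2))) := by
  have := hν.isProb
  have hz0 : z ≠ 0 := fun h => by simp [h] at hz
  have hae := ae_norm_eq_one hν.onCircle
  obtain ⟨h1, h2⟩ := transferZ_conj (α := α) (lam := lam) hz q
  have hdet := transferZ_norm_sq (α := α) (lam := lam) hz q
  rw [hq.neg_one_pow] at hdet
  have hD : transferZ α lam z q 1 1 - transferZ α lam z q 0 0 - 2 * transferZ α lam z q 0 1 * w
      ≠ 0 := by
    have h' := h
    rw [h1, h2] at h'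
    rw [h1]
    exact elliptic_dual_ne_zero h' hdet hΔ hw
  have ht := (tendsto_finsetSum (Finset.range q) fun r _ =>
    tendsto_diagLimit hz0 hD nhdsWithin_le_nhds hW r).const_mul (q : ℂ)⁻¹
  have ht2 := (Complex.continuous_re.tendsto _).comp ht
  simp only [diagLimit_boundary hq hz hΔ hw h] at ht2
  rw [← Complex.ofReal_sum, ← Complex.ofReal_natCast, ← Complex.ofReal_inv, ← Complex.ofReal_mul,
    Complex.ofReal_re] at ht2
  refine ht2.congr' ?_
  filter_upwards [eventually_ball hz] with x hx
  rw [Function.comp_apply, Complex.ofReal_inv, Complex.ofReal_natCast,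
    ← herglotz_densityOfStates hq0 hq hα hlam hν hx.1 hx.2]
  exact (integral_re (integrable_herglotz hae hx.1)).symm

end CMV
end

/-! ### Even shifts and the lower bound on the density -/

noncomputable section
namespace CMV

open scoped Matrix

variable {α : ℕ → UnitDisc} {lam : ℕ → Circle} {z : ℂ} {q : ℕ}

/-- The discriminant does not change under even shifts of the coefficients. -/
lemma trace_transferZ_shift (hq : Even q) (hα : ∀ n, α (n + q) = α n)
    (hlam : ∀ n, lam (n + q) = lam n) (hz : z ≠ 0) {p : ℕ} (hp : Even p) :
    (transferZ (fun n => α (n + p)) (fun n => lam (n + p)) z q).trace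
      = (transferZ α lam z q).trace := by
  have h1 := transferZ_add_even α lam z q hp
  have h2 := transferZ_add_mul α lam hq hα hlam z p 1
  rw [mul_one, pow_one, Nat.add_comm] at h2
  rw [h1] at h2
  have hdet : IsUnit (transferZ α lam z p).det := by
    rw [det_transferZ α lam hz]
    exact (isUnit_one.neg).pow p
  have h3 : transferZ (fun n => α (n + p)) (fun n => lam (n + p)) z q
      = transferZ α lam z p * transferZ α lam z q * (transferZ α lam z p)⁻¹ := by
    rw [← h2, Matrix.mul_assoc, Matrix.mul_nonsing_inv _ hdet, Matrix.mul_one]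
  rw [h3, Matrix.trace_mul_comm, ← Matrix.mul_assoc, Matrix.nonsing_inv_mul _ hdet, Matrix.one_mul]

/-- Boundary values of the Schur functions of the even shifts of a periodic CMV matrix. -/
lemma exists_tendsto_schur_shift (hq0 : 0 < q) (hq : Even q) (hα : ∀ n, α (n + q) = α n)
    (hlam : ∀ n, lam (n + q) = lam n) (hz : ‖z‖ = 1) (hΔ : |(transferZ α lam z q 0 0).re| < 1)
    {w : ℂ} (hW : Tendsto (fun x => x * schur α lam x) (𝓝[Metric.ball (0 : ℂ) 1] z) (𝓝 w))
    {p : ℕ} (hp : Even p) :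
    ∃ s, Tendsto (schur (fun n => α (n + p)) (fun n => lam (n + p)))
        (𝓝[Metric.ball (0 : ℂ) 1] z) (𝓝 s) ∧ ‖s‖ < 1 ∧
      ‖(transferZ α lam z p *ᵥ ![1, w]) 1‖ = ‖s‖ * ‖(transferZ α lam z p *ᵥ ![1, w]) 0‖ := by
  have hz0 : z ≠ 0 := fun h => by simp [h] at hz
  have hne := neBot_nhdsWithin_ball hz
  have hΔ' : |(transferZ (fun n => α (n + p)) (fun n => lam (n + p)) z q 0 0).re| < 1 := by
    rw [← discriminant_mem_iff hz, discriminant] at hΔ ⊢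
    rwa [trace_transferZ_shift hq hα hlam hz0 hp]
  obtain ⟨w', hW', hw', -⟩ := exists_tendsto_schur (α := fun n => α (n + p))
    (lam := fun n => lam (n + p)) hq0 hq (fun n => by rw [Nat.add_right_comm, hα])
    (fun n => by rw [Nat.add_right_comm, hlam]) hz hΔ'
  have hx : Tendsto (fun x : ℂ => x) (𝓝[Metric.ball (0 : ℂ) 1] z) (𝓝 z) := nhdsWithin_le_nhds
  refine ⟨w' / z, ?_, by rwa [norm_div, hz, div_one], ?_⟩
  · refine (hW'.div hx hz0).congr' ?_
    filter_upwards [eventually_ball hz] with x hx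
    have := hx.2
    simp only [Pi.div_apply]
    field_simp
  · have hZ : ∀ i j, Tendsto (fun x => transferZ α lam x p i j) (𝓝[Metric.ball (0 : ℂ) 1] z)
        (𝓝 (transferZ α lam z p i j)) := fun i j =>
      (continuousAt_transferZ_apply hz0 p i j).tendsto.mono_left nhdsWithin_le_nhds
    have h1 : Tendsto (fun x => (transferZ α lam x p 0 0 +
        transferZ α lam x p 0 1 * (x * schur α lam x)) *
          (x * schur (fun n => α (n + p)) (fun n => lam (n + p)) x) -
        (transferZ α lam x p 1 0 + transferZ α lam x p 1 1 * (x * schur α lam x)))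
        (𝓝[Metric.ball (0 : ℂ) 1] z) (𝓝 ((transferZ α lam z p 0 0 + transferZ α lam z p 0 1 * w) *
          w' - (transferZ α lam z p 1 0 + transferZ α lam z p 1 1 * w))) :=
      (((hZ 0 0).add ((hZ 0 1).mul hW)).mul hW').sub ((hZ 1 0).add ((hZ 1 1).mul hW))
    have h2 : (transferZ α lam z p 0 0 + transferZ α lam z p 0 1 * w) * w'
        - (transferZ α lam z p 1 0 + transferZ α lam z p 1 1 * w) = 0 := by
      refine tendsto_nhds_unique h1 (tendsto_const_nhds.congr' ?_)
      filter_upwards [eventually_ball hz] with x hx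
      -- The decaying solution moved to site `p` decays for the shifted coefficients, so it is
      -- parallel to `(1, x s_p(x))`.
      have h3 := ((decays_schur α lam hx.1 hx.2).shift hp).wedge_eq_zero hx.2
        (decays_schur (fun n => α (n + p)) (fun n => lam (n + p)) hx.1 hx.2)
      simp [Matrix.mulVec, dotProduct, Fin.sum_univ_two] at h3
      exact h3.symm
    have h4 : (transferZ α lam z p *ᵥ ![1, w]) 1 = w' * (transferZ α lam z p *ᵥ ![1, w]) 0 := by
      simp [Matrix.mulVec, dotProduct, Fin.sum_univ_two]
      linear_combination -h2
    rw [h4, norm_mul, norm_div, hz, div_one]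

lemma sum_range_even_add_odd (f : ℕ → ℝ) (m : ℕ) :
    ∑ r ∈ Finset.range (2 * m), f r = ∑ j ∈ Finset.range m, (f (2 * j) + f (2 * j + 1)) := by
  induction m with
  | zero => simp
  | succ m ih =>
    rw [Nat.mul_succ, Finset.sum_range_succ, Finset.sum_range_succ, ih, Finset.sum_range_succ]
    ring

/-- The even term is `(1 + s²) / (1 - s²)`; the odd one is at least `1`, since `P' + R' = κ + 2 P'`.
These add up to the stated bound. -/
lemma two_div_le_of_forms {P R P' R' κ s : ℝ} (hκ : 0 < κ) (hP : 0 ≤ P') (h1 : P - R = κ)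
    (h2 : P' - R' = -κ) (hs : R = s ^ 2 * P) :
    2 / (1 - s ^ 2) ≤ (P + R) / κ + (P' + R') / κ := by
  have h3 : P * (1 - s ^ 2) = κ := by rw [← h1, hs]; ring
  have hP0 : P ≠ 0 := fun h => by rw [h, zero_mul] at h3; exact hκ.ne h3
  have hs0 : 1 - s ^ 2 ≠ 0 := fun h => by rw [h, mul_zero] at h3; exact hκ.ne h3
  have h4 : 2 / (1 - s ^ 2) = 2 * P / κ := by
    rw [← h3]; field_simp
  rw [h4, ← add_div]
  gcongr
  linarith

end CMV
end

theorem theorem8p2 (q : ℕ) (hq : 0 < q) (hq_even : Even q)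
    (α : ℕ → Complex.UnitDisc) (lam : ℕ → Circle)
    (hα : ∀ n, α (n + q) = α n) (hlam : ∀ n, lam (n + q) = lam n) :
    (∃ ν : Measure ℂ, CMV.IsDensityOfStates (CMV.cmv α lam) ν) ∧
    ∀ ν : Measure ℂ, CMV.IsDensityOfStates (CMV.cmv α lam) ν →
      ∀ τ : ℝ,
        CMV.discriminant q α lam (Complex.exp (τ * Complex.I)) ∈
          (fun x : ℝ => (x : ℂ)) '' Set.Ioo (-2) 2 →
        ∃ (s : ℕ → ℂ) (d : ℝ),
          (∀ j < q / 2,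
            Tendsto (CMV.schur (fun n => α (n + 2 * j)) (fun n => lam (n + 2 * j)))
              (𝓝[Metric.ball (0 : ℂ) 1] (Complex.exp (τ * Complex.I))) (𝓝 (s j)) ∧
            ‖s j‖ < 1) ∧
          HasDerivAt (CMV.angularCDF ν τ) d τ ∧
          1 / (Real.pi * q) * ∑ j ∈ Finset.range (q / 2), 1 / (1 - ‖s j‖ ^ 2) ≤ d := by
  refine ⟨CMV.exists_isDensityOfStates α lam hq hq_even hα hlam, fun ν hν τ hτ => ?_⟩
  have := hν.isProb
  have hnorm : ∀ t : ℝ, ‖Complex.exp (t * Complex.I)‖ = 1 := Complex.norm_exp_ofReal_mul_I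
  have hae := CMV.ae_norm_eq_one hν.onCircle
  rw [CMV.discriminant_mem_iff (hnorm τ)] at hτ
  have hopen : ∀ᶠ t : ℝ in 𝓝 τ,
      |(CMV.transferZ α lam (Complex.exp (t * Complex.I)) q 0 0).re| < 1 := by
    have h1 : ContinuousAt (fun t : ℝ => CMV.transferZ α lam (Complex.exp (t * Complex.I)) q 0 0) τ :=
      (CMV.continuousAt_transferZ_apply (Complex.exp_ne_zero _) q 0 0).comp
        (f := fun t : ℝ => Complex.exp (t * Complex.I)) (by fun_prop)
    exact (Complex.continuous_re.continuousAt.comp h1).abs.eventually_lt continuousAt_const hτ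
  obtain ⟨ε, hε, hball⟩ := Metric.eventually_nhds_iff_ball.1 hopen
  -- The density at `τ` needs boundary values on a whole arc, which openness of the band provides.
  -- The cap `1` keeps the arc inside the window of `angularCDF`.
  have hlim : ∀ t : ℝ, ∃ y : ℝ, t ∈ Ioo (τ - min ε 1) (τ + min ε 1) →
      Tendsto (CMV.poissonIntegral ν) (𝓝[Metric.ball (0 : ℂ) 1] (Complex.exp (t * Complex.I)))
        (𝓝 y) := by
    intro t
    by_cases ht : t ∈ Ioo (τ - min ε 1) (τ + min ε 1)
    · have hΔ := hball t (by
        rw [Real.ball_eq_Ioo]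
        exact ⟨by linarith [ht.1, min_le_left ε 1], by linarith [ht.2, min_le_left ε 1]⟩)
      obtain ⟨w, hW, hw, h⟩ := CMV.exists_tendsto_schur hq hq_even hα hlam (hnorm t) hΔ
      exact ⟨_, fun _ => CMV.tendsto_poissonIntegral_densityOfStates hq hq_even hα hlam hν
        (hnorm t) hΔ hW hw h⟩
    · exact ⟨0, fun h => absurd h ht⟩
  choose g hg using hlim
  have hεpos : 0 < min ε 1 := lt_min hε one_pos
  have hderiv := CMV.hasDerivAt_angularCDF hae hεpos (min_le_right _ _) hg
  obtain ⟨w, hW, hw, h⟩ := CMV.exists_tendsto_schur hq hq_even hα hlam (hnorm τ) hτ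
  have hne := CMV.neBot_nhdsWithin_ball (hnorm τ)
  have hgτ := tendsto_nhds_unique (hg τ ⟨by linarith, by linarith⟩)
    (CMV.tendsto_poissonIntegral_densityOfStates hq hq_even hα hlam hν (hnorm τ) hτ hW hw h)
  choose s hs1 hs2 hs3 using fun j : ℕ => CMV.exists_tendsto_schur_shift hq hq_even hα hlam
    (hnorm τ) hτ hW (even_two_mul j)
  refine ⟨s, _, fun j _ => ⟨hs1 j, hs2 j⟩, hderiv, ?_⟩
  obtain ⟨m, rfl⟩ := hq_even.two_dvd
  have hm : 2 * m / 2 = m := by omega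
  have hκ : 0 < 1 - ‖w‖ ^ 2 := by nlinarith [norm_nonneg w]
  rw [hgτ, CMV.sum_range_even_add_odd, hm]
  have hm0 : (0 : ℝ) < ((2 * m : ℕ) : ℝ) := by exact_mod_cast hq
  have e : 1 / (Real.pi * ((2 * m : ℕ) : ℝ)) * ∑ j ∈ Finset.range m, 1 / (1 - ‖s j‖ ^ 2)
      = (2 * Real.pi)⁻¹ * (((2 * m : ℕ) : ℝ)⁻¹ * ∑ j ∈ Finset.range m, 2 / (1 - ‖s j‖ ^ 2)) := by
    have : ∀ j, 2 / (1 - ‖s j‖ ^ 2) = 2 * (1 / (1 - ‖s j‖ ^ 2)) := fun j => by ring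
    simp only [this, ← Finset.mul_sum]
    have := Real.pi_pos
    field_simp
  rw [e]
  have := Real.pi_pos
  gcongr with j hj
  refine CMV.two_div_le_of_forms hκ (sq_nonneg _) ?_ ?_ ?_
  · have := CMV.transferZ_form (α := α) (lam := lam) (hnorm τ) (2 * j) w
    rwa [(even_two_mul j).neg_one_pow, one_mul] at this
  · have := CMV.transferZ_form (α := α) (lam := lam) (hnorm τ) (2 * j + 1) w
    rwa [(odd_two_mul_add_one j).neg_one_pow, neg_one_mul] at this
  · rw [hs3, mul_pow]
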